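/- Let $m\ge 1$ and let $W\in C^2(\mathbb R^m\times\mathbb R^m;[0,\infty))$ satisfy: (H1) the set $A=\{u\in\mathbb R^m: W(u,0)=0\}$ is partitioned into two nonempty disjoint compact sets $A^-$ and $A^+$; (H2) there is an open set $\Omega\subset\mathbb R^m$ with $A^-\subset\Omega$, $A^+\cap\overline\Omega=\emptyset$, and $W(u,v)>0$ for all $u\in\partial\Omega$ and all $v\in\mathbb R^m$; (H3) $\liminf_{|u|\to\infty}W(u,v)>0$ uniformly in $v\in\mathbb R^m$. Let $d$ be the Euclidean distance, and let $0<q<\frac12 d(A^-,A^+)$ be such that $\{u: d(u,A^-)\le q\}\subset\Omega$ and $\{u: d(u,A^+)\le q\}\cap\overline\Omega=\emptyset$. Let $\mathcal A$ be the class of all $u\in W^{2,2}_{\rm loc}(\mathbb R;\mathbb R^m)$ (identified with their continuous representatives) for which there are $x_u^-<x_u^+$ with $d(u(x),A^-)\le q$ for $x\le x_u^-$ and $d(u(x),A^+)\le q$ for $x\ge x_u^+$, and let $$J_{\mathbb R}(u)=\int_{\mathbb R}\Big(\tfrac12|u''|^2+W(u,u')\Big)\,dx\in[0,\infty].$$ Assume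 that $A^-$ is a $C^2$ compact orientable hypersurface of $\mathbb R^m$ with unit normal $\mathbf n$, and that $W$ is nondegenerate in the directions normal to $A^-\times\{0\}$, that is, $$\frac{d^2}{ds^2}W\big(a+s\alpha\,\mathbf n(a),\,s\nu\big)\Big|_{s=0}>0\qquad\text{for all } a\in A^-,\ \alpha\in\mathbb R,\ \nu\in\mathbb R^m\text{ with }\alpha^2+|\nu|^2=1.$$ Then every minimizer $\bar u$ of $J_{\mathbb R}$ in $\mathcal A$ is of class $C^1$, and there are constants $K,k>0$ such that $$d(\bar u(x),A^-)\le Ke^{kx}\quad\text{and}\quad|\bar u'(x)|\le Ke^{kx}\qquad\text{for all }x\le 0.$$ -/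

import Mathlib

open MeasureTheory Set
open scoped ContDiff ENNReal RealInnerProductSpace

/-- `g` is a weak derivative of `f` on the real line: both are locally integrable and
`∫ φ' f = - ∫ φ g` for every real test function `φ ∈ C_c^∞(ℝ)`. -/
def IsWeakDeriv {m : ℕ} (f g : ℝ → EuclideanSpace ℝ (Fin m)) : Prop :=
  LocallyIntegrable f volume ∧ LocallyIntegrable g volume ∧
    ∀ φ : ℝ → ℝ, ContDiff ℝ ∞ φ → HasCompactSupport φ →
      ∫ x, deriv φ x • f x = - ∫ x, φ x • g x

/-- A chosen weak derivative of `f`, if there is one. It is determined almost everywhere. -/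
noncomputable def weakDeriv {m : ℕ} (f : ℝ → EuclideanSpace ℝ (Fin m)) :
    ℝ → EuclideanSpace ℝ (Fin m) :=
  Classical.epsilon fun g => IsWeakDeriv f g

/-- `f ∈ L²_loc(ℝ; ℝ^m)`. -/
def MemL2loc {m : ℕ} (f : ℝ → EuclideanSpace ℝ (Fin m)) : Prop :=
  ∀ K : Set ℝ, IsCompact K → MemLp f 2 (volume.restrict K)

/-- `u` is the continuous representative of an element of `W^{2,2}_loc(ℝ; ℝ^m)`: the first and
the second weak derivatives exist and lie in `L²_loc` (and so does `u`, being continuous). -/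
def MemW22loc {m : ℕ} (u : ℝ → EuclideanSpace ℝ (Fin m)) : Prop :=
  Continuous u ∧ ∃ u₁ u₂ : ℝ → EuclideanSpace ℝ (Fin m),
    IsWeakDeriv u u₁ ∧ IsWeakDeriv u₁ u₂ ∧ MemL2loc u₁ ∧ MemL2loc u₂

/-- The energy `∫_ℝ (|u''|² / 2 + W(u, u'))`, with values in `[0, ∞]`
(it is used for nonnegative `W` and `u ∈ W^{2,2}_loc`). -/
noncomputable def energy {m : ℕ}
    (W : EuclideanSpace ℝ (Fin m) × EuclideanSpace ℝ (Fin m) → ℝ)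
    (u : ℝ → EuclideanSpace ℝ (Fin m)) : ℝ≥0∞ :=
  ∫⁻ x, ENNReal.ofReal
    (1 / 2 * ‖weakDeriv (weakDeriv u) x‖ ^ 2 + W (u x, weakDeriv u x))

/-- The class of `W^{2,2}_loc` maps that stay within distance `q` of `Am` near `-∞` and within
distance `q` of `Ap` near `+∞`. -/
def admissible {m : ℕ} (Am Ap : Set (EuclideanSpace ℝ (Fin m))) (q : ℝ) :
    Set (ℝ → EuclideanSpace ℝ (Fin m)) :=
  {u | MemW22loc u ∧ ∃ xm xp : ℝ, xm < xp ∧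
    (∀ x ≤ xm, Metric.infDist (u x) Am ≤ q) ∧ (∀ x ≥ xp, Metric.infDist (u x) Ap ≤ q)}

/-- `u` minimizes the energy in the admissible class. -/
def IsMinimizer {m : ℕ} (W : EuclideanSpace ℝ (Fin m) × EuclideanSpace ℝ (Fin m) → ℝ)
    (Am Ap : Set (EuclideanSpace ℝ (Fin m))) (q : ℝ)
    (u : ℝ → EuclideanSpace ℝ (Fin m)) : Prop :=
  u ∈ admissible Am Ap q ∧ ∀ w ∈ admissible Am Ap q, energy W u ≤ energy W w

/-- `g` is a `C²` defining function of `S` in the open set `U`: `S ∩ U = {g = 0} ∩ U`, and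
`dg` does not vanish in `U`. -/
def IsDefiningFunction {m : ℕ} (S U : Set (EuclideanSpace ℝ (Fin m)))
    (g : EuclideanSpace ℝ (Fin m) → ℝ) : Prop :=
  IsOpen U ∧ ContDiffOn ℝ 2 g U ∧ (∀ x ∈ U, fderiv ℝ g x ≠ 0) ∧ ∀ x ∈ U, x ∈ S ↔ g x = 0

/-- `S` is an embedded hypersurface of class `C²` of `ℝ^m` (dimension `m - 1`, no boundary). -/
def IsC2Hypersurface {m : ℕ} (S : Set (EuclideanSpace ℝ (Fin m))) : Prop :=
  ∀ a ∈ S, ∃ U g, a ∈ U ∧ IsDefiningFunction S U g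

/-- `n` is a continuous unit normal field on the hypersurface `S`, i.e. `n a` is orthogonal to the
tangent space `T_a S = ker dg(a)`. Its existence is the orientability of `S`. -/
def IsUnitNormalField {m : ℕ} (S : Set (EuclideanSpace ℝ (Fin m)))
    (n : EuclideanSpace ℝ (Fin m) → EuclideanSpace ℝ (Fin m)) : Prop :=
  ContinuousOn n S ∧ ∀ a ∈ S, ‖n a‖ = 1 ∧
    ∀ U g, a ∈ U → IsDefiningFunction S U g → ∀ w, fderiv ℝ g a w = 0 → ⟪n a, w⟫ = 0

/-! Write `E x` for the energy of the minimizer on `(-∞, x]`. Two estimates turn minimality into a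
differential inequality for `E`. Upper bound (`IsMinimizer.setIntegral_Iic_density_le`): replacing
`u` on the left of `x` by a cubic arc starting at rest at the point `a` of `Am` nearest to `u x`
costs `O((|u x - a| + |u' x|)²)`, because `W` vanishes to second order at `(a, 0)`. Lower bound
(`exists_nondegenerate_lower_bound`): since `u x - a` is normal to `Am`, nondegeneracy gives `c (d(u
x, Am)² + |u' x|²) ≤ W(u x, u' x)` close to `Am × {0}`. Hence `E ≤ B W(u, u') ≤ B E'` almost
everywhere near `-∞`, and a Gronwall argument (`exists_exp_bound_setIntegral_Iic`) makes `E` decay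
exponentially. Pointwise decay, at half the rate, follows by interpolation
(`HasSecondDeriv.exists_exp_bound`). Both estimates require `u` to be close to `Am` and `u'` to be
small; finite energy gives this near `-∞` (`HasSecondDeriv.tendsto_deriv_atBot`,
`HasSecondDeriv.tendsto_infDist_atBot`). -/

/-! ### Weak derivatives on the line and primitives. -/

theorem MeasureTheory.LocallyIntegrable.intervalIntegrable_real {F : Type*} [NormedAddCommGroup F]
    {f : ℝ → F} (hf : LocallyIntegrable f) (a b : ℝ) : IntervalIntegrable f volume a b :=
  (hf.integrableOn_isCompact isCompact_uIcc).intervalIntegrable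

theorem HasCompactSupport.exists_tsupport_subset_Ioo {F : Type*} [Zero F] {φ : ℝ → F}
    (hc : HasCompactSupport φ) : ∃ R₀ : ℝ, 0 < R₀ ∧ ∀ R ≥ R₀, tsupport φ ⊆ Ioo (-R) R := by
  obtain ⟨R, hR⟩ := hc.isBounded.subset_ball 0
  refine ⟨max R 1, by positivity, fun S hS x hx => ?_⟩
  have := hR hx
  rw [Metric.mem_ball, dist_zero_right, Real.norm_eq_abs, abs_lt] at this
  have := le_max_left R 1
  constructor <;> linarith

theorem tsupport_eq_zero_of_notMem {F : Type*} [Zero F] {φ : ℝ → F} {s : Set ℝ}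
    (h : tsupport φ ⊆ s) {x : ℝ} (hx : x ∉ s) : φ x = 0 :=
  image_eq_zero_of_notMem_tsupport fun hx' => hx (h hx')

/-- Integration by parts of a real primitive against a test function. -/
theorem integral_deriv_mul_primitive {z v φ : ℝ → ℝ} (hz : LocallyIntegrable z)
    (hv : ∀ a b, ∫ t in a..b, z t = v b - v a)
    (hφ : ContDiff ℝ ∞ φ) (hc : HasCompactSupport φ) :
    ∫ x, deriv φ x * v x = - ∫ x, φ x * z x := by
  obtain ⟨R, hR0, hR⟩ := hc.exists_tsupport_subset_Ioo
  have hR := hR R le_rfl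
  have hφR : φ R = 0 := tsupport_eq_zero_of_notMem hR (by simp)
  have hφR' : φ (-R) = 0 := tsupport_eq_zero_of_notMem hR (by simp)
  have hv' : v = fun x => v (-R) + ∫ t in (-R)..x, z t := by
    funext x; rw [hv]; ring
  have hii : IntervalIntegrable z volume (-R) R := hz.intervalIntegrable_real _ _
  have hac : AbsolutelyContinuousOnInterval v (-R) R := by
    have h1 : AbsolutelyContinuousOnInterval (fun _ : ℝ => v (-R)) (-R) R :=
      (contDiff_const (n := 1)).contDiffOn.absolutelyContinuousOnInterval
    rw [hv']
    exact h1.add (hii.absolutelyContinuousOnInterval_intervalIntegral (c := -R) (by simp))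
  have hφac : AbsolutelyContinuousOnInterval φ (-R) R :=
    (hφ.of_le (m := 1) (by exact_mod_cast le_top)).contDiffOn.absolutelyContinuousOnInterval
  have key := hφac.integral_mul_deriv_eq_deriv_mul hac
  rw [hφR, hφR'] at key
  have hd : ∀ᵐ x, deriv v x = z x := by
    filter_upwards [LocallyIntegrable.ae_hasDerivAt_integral hz] with x hx
    have := (hx (-R)).const_add (v (-R))
    rw [← hv'] at this
    exact this.deriv
  have e1 : ∫ x in (-R)..R, φ x * deriv v x = ∫ x in (-R)..R, φ x * z x :=
    intervalIntegral.integral_congr_ae (by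
      filter_upwards [hd] with x hx _
      rw [hx])
  have e2 : ∫ x in (-R)..R, φ x * z x = ∫ x, φ x * z x := by
    apply intervalIntegral.integral_eq_integral_of_support_subset
    intro x hx
    exact Ioo_subset_Ioc_self (hR (subset_tsupport _ (left_ne_zero_of_mul hx)))
  have e3 : ∫ x in (-R)..R, deriv φ x * v x = ∫ x, deriv φ x * v x := by
    apply intervalIntegral.integral_eq_integral_of_support_subset
    intro x hx
    exact Ioo_subset_Ioc_self (hR (support_deriv_subset (left_ne_zero_of_mul hx)))
  rw [← e3, ← e2, ← e1, key]
  ring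

theorem continuous_of_integral_eq_sub {F : Type*} [NormedAddCommGroup F] [NormedSpace ℝ F]
    {z v : ℝ → F} (hz : LocallyIntegrable z)
    (hv : ∀ a b, ∫ t in a..b, z t = v b - v a) : Continuous v := by
  have : v = fun x => v 0 + ∫ t in (0 : ℝ)..x, z t := by
    funext x; rw [hv]; abel
  rw [this]
  exact continuous_const.add
    (intervalIntegral.continuous_primitive hz.intervalIntegrable_real 0)

/-- A primitive of a locally integrable function has this function as weak derivative. -/
theorem isWeakDeriv_of_integral_eq_sub {m : ℕ} {z v : ℝ → EuclideanSpace ℝ (Fin m)}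
    (hz : LocallyIntegrable z) (hv : ∀ a b, ∫ t in a..b, z t = v b - v a) :
    IsWeakDeriv v z := by
  have hvc := continuous_of_integral_eq_sub hz hv
  refine ⟨hvc.locallyIntegrable, hz, fun φ hφ hc => ?_⟩
  have hφ1 : Continuous (deriv φ) := hφ.continuous_deriv (by exact_mod_cast le_top)
  have i1 : Integrable fun x => deriv φ x • v x :=
    hvc.locallyIntegrable.integrable_smul_left_of_hasCompactSupport hφ1 hc.deriv
  have i2 : Integrable fun x => φ x • z x :=
    hz.integrable_smul_left_of_hasCompactSupport hφ.continuous hc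
  ext i
  have p1 := (EuclideanSpace.proj (𝕜 := ℝ) i).integral_comp_comm i1
  have p2 := (EuclideanSpace.proj (𝕜 := ℝ) i).integral_comp_comm i2
  simp only [PiLp.proj_apply, PiLp.smul_apply, smul_eq_mul, PiLp.neg_apply] at p1 p2 ⊢
  rw [← p1, ← p2]
  refine integral_deriv_mul_primitive (z := fun x => z x i) (v := fun x => v x i) ?_ ?_ hφ hc
  · intro x
    obtain ⟨s, hs, hs'⟩ := hz x
    exact ⟨s, hs, (EuclideanSpace.proj (𝕜 := ℝ) i).integrable_comp hs'⟩
  · intro a b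
    have := (EuclideanSpace.proj (𝕜 := ℝ) i).intervalIntegral_comp_comm
      (hz.intervalIntegrable_real a b)
    simp only [PiLp.proj_apply] at this
    rw [this, hv, PiLp.sub_apply]

/-- The primitive started left of the support is constant to its right, with value the total
integral; zero mean is what makes it compactly supported. -/
theorem exists_test_function_deriv_eq {ψ : ℝ → ℝ} (hψ : ContDiff ℝ ∞ ψ)
    (hc : HasCompactSupport ψ) (h0 : ∫ x, ψ x = 0) :
    ∃ φ : ℝ → ℝ, ContDiff ℝ ∞ φ ∧ HasCompactSupport φ ∧ deriv φ = ψ := by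
  obtain ⟨R, hR0, hR⟩ := hc.exists_tsupport_subset_Ioo
  have hR := hR R le_rfl
  have hd : ∀ x, HasDerivAt (fun x => ∫ t in (-R)..x, ψ t) (ψ x) x := fun x =>
    (hψ.continuous.integral_hasStrictDerivAt (-R) x).hasDerivAt
  have hd' : deriv (fun x => ∫ t in (-R)..x, ψ t) = ψ := funext fun x => (hd x).deriv
  refine ⟨fun x => ∫ t in (-R)..x, ψ t, ?_, ?_, hd'⟩
  · rw [contDiff_infty_iff_deriv, hd']
    exact ⟨fun x => (hd x).differentiableAt, hψ⟩
  · refine HasCompactSupport.intro (isCompact_Icc (a := -R) (b := R)) fun x hx => ?_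
    have hsupp : ∀ t, t ∉ Ioo (-R) R → ψ t = 0 := fun t => tsupport_eq_zero_of_notMem hR
    rcases lt_or_ge x (-R) with h | h
    · refine intervalIntegral.integral_zero_ae (Filter.Eventually.of_forall fun t ht => hsupp t ?_)
      rw [uIoc_of_ge h.le] at ht
      exact fun h' => absurd h'.1 (not_lt.2 ht.2)
    · have hx' : R < x := by
        by_contra hcon
        exact hx ⟨h, not_lt.1 hcon⟩
      change ∫ t in (-R)..x, ψ t = 0
      rw [intervalIntegral.integral_eq_integral_of_support_subset, h0]
      intro t ht
      have := hR (subset_tsupport _ ht)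
      exact ⟨this.1, by linarith [this.2]⟩

/-- The **du Bois-Reymond lemma** on the line. -/
theorem ae_eq_const_of_integral_deriv_smul_eq_zero {F : Type*} [NormedAddCommGroup F]
    [NormedSpace ℝ F] [CompleteSpace F] {f : ℝ → F} (hf : LocallyIntegrable f)
    (h : ∀ φ : ℝ → ℝ, ContDiff ℝ ∞ φ → HasCompactSupport φ → ∫ x, deriv φ x • f x = 0) :
    ∃ c, ∀ᵐ x, f x = c := by
  let b : ContDiffBump (0 : ℝ) := default
  set ρ : ℝ → ℝ := b.normed volume with hρ
  have hρs : ContDiff ℝ ∞ ρ := b.contDiff_normed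
  have hρc : HasCompactSupport ρ := b.hasCompactSupport_normed
  have hρ1 : ∫ x, ρ x = 1 := b.integral_normed
  -- The constant is the `ρ`-average of `f`: subtracting `(∫ g) ρ` from a test function `g` leaves
  -- mean zero, hence a derivative of a test function.
  refine ⟨∫ x, ρ x • f x, ae_eq_of_integral_contDiff_smul_eq hf
    (locallyIntegrable_const _) fun g hg hgc => ?_⟩
  have hgi : Integrable g := hg.continuous.integrable_of_hasCompactSupport hgc
  have hρi : Integrable ρ := hρs.continuous.integrable_of_hasCompactSupport hρc
  obtain ⟨φ, hφ, hφc, hφd⟩ := exists_test_function_deriv_eq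
    (ψ := fun x => g x - (∫ t, g t) * ρ x) (hg.sub (contDiff_const.mul hρs))
    (hgc.sub (hρc.mul_left (f := fun _ => ∫ t, g t)))
    (by rw [integral_sub hgi (hρi.const_mul _), integral_const_mul, hρ1]; ring)
  have := h φ hφ hφc
  rw [hφd] at this
  simp only [sub_smul, mul_smul] at this
  have hi : Integrable fun x => (∫ t, g t) • ρ x • f x :=
    (hf.integrable_smul_left_of_hasCompactSupport hρs.continuous hρc).smul _
  rw [integral_sub (hf.integrable_smul_left_of_hasCompactSupport hg.continuous hgc) hi,
    integral_smul, sub_eq_zero] at this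
  rw [this, integral_smul_const]

theorem IsWeakDeriv.ae_eq {m : ℕ} {f g g' : ℝ → EuclideanSpace ℝ (Fin m)}
    (h : IsWeakDeriv f g) (h' : IsWeakDeriv f g') : ∀ᵐ x, g x = g' x :=
  ae_eq_of_integral_contDiff_smul_eq h.2.1 h'.2.1 fun φ hφ hc => by
    have := (h.2.2 φ hφ hc).symm.trans (h'.2.2 φ hφ hc)
    simpa using this

theorem LocallyIntegrable.congr_ae {F : Type*} [NormedAddCommGroup F] {f g : ℝ → F}
    (hf : LocallyIntegrable f) (h : ∀ᵐ x, f x = g x) : LocallyIntegrable g := fun x => by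
  obtain ⟨s, hs, hs'⟩ := hf x
  exact ⟨s, hs, hs'.congr_fun_ae (ae_restrict_of_ae h)⟩

theorem IsWeakDeriv.congr {m : ℕ} {f f' g : ℝ → EuclideanSpace ℝ (Fin m)}
    (h : IsWeakDeriv f g) (hf : ∀ᵐ x, f x = f' x) :
    IsWeakDeriv f' g := by
  refine ⟨LocallyIntegrable.congr_ae h.1 hf, h.2.1, fun φ hφ hc => ?_⟩
  rw [← h.2.2 φ hφ hc]
  refine integral_congr_ae ?_
  filter_upwards [hf] with x hx
  rw [hx]

theorem IsWeakDeriv.ae_eq_weakDeriv {m : ℕ} {f g : ℝ → EuclideanSpace ℝ (Fin m)}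
    (h : IsWeakDeriv f g) : ∀ᵐ x, g x = weakDeriv f x :=
  h.ae_eq (Classical.epsilon_spec (p := fun g => IsWeakDeriv f g) ⟨g, h⟩)

/-- A function with a weak derivative agrees almost everywhere with a primitive of it. -/
theorem IsWeakDeriv.exists_primitive {m : ℕ} {f g : ℝ → EuclideanSpace ℝ (Fin m)}
    (h : IsWeakDeriv f g) : ∃ v : ℝ → EuclideanSpace ℝ (Fin m),
      (∀ᵐ x, f x = v x) ∧ ∀ a b, ∫ t in a..b, g t = v b - v a := by
  have hgi : ∀ a b, IntervalIntegrable g volume a b := h.2.1.intervalIntegrable_real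
  set w : ℝ → EuclideanSpace ℝ (Fin m) := fun x => ∫ t in (0 : ℝ)..x, g t with hw
  have hwd : ∀ a b, ∫ t in a..b, g t = w b - w a := fun a b =>
    (intervalIntegral.integral_interval_sub_left (hgi _ _) (hgi _ _)).symm
  have hww := isWeakDeriv_of_integral_eq_sub h.2.1 hwd
  obtain ⟨c, hc⟩ := ae_eq_const_of_integral_deriv_smul_eq_zero (f := fun x => f x - w x)
    (h.1.sub hww.1) fun φ hφ hcs => by
      have hφ1 : Continuous (deriv φ) := hφ.continuous_deriv (by exact_mod_cast le_top)
      simp only [smul_sub]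
      rw [integral_sub (h.1.integrable_smul_left_of_hasCompactSupport hφ1 hcs.deriv)
        (hww.1.integrable_smul_left_of_hasCompactSupport hφ1 hcs.deriv),
        h.2.2 φ hφ hcs, hww.2.2 φ hφ hcs, sub_self]
  refine ⟨fun x => c + w x, ?_, fun a b => by rw [hwd]; simp⟩
  filter_upwards [hc] with x hx
  rw [← hx]; abel

/-! ### Classical representatives of `W^{2,2}_loc` maps and gluing. -/

/-- `v` is the classical derivative of `u`, and `v` is a primitive of `z ∈ L²_loc`. -/
structure HasSecondDeriv {m : ℕ} (u v z : ℝ → EuclideanSpace ℝ (Fin m)) : Prop where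
  hasDerivAt : ∀ x, HasDerivAt u (v x) x
  integral_eq_sub : ∀ a b, ∫ t in a..b, z t = v b - v a
  memL2loc : MemL2loc z

theorem MemL2loc.locallyIntegrable {m : ℕ} {z : ℝ → EuclideanSpace ℝ (Fin m)} (hz : MemL2loc z) :
    LocallyIntegrable z := by
  rw [locallyIntegrable_iff]
  intro K hK
  have : IsFiniteMeasure (volume.restrict K) := ⟨by simpa using hK.measure_lt_top⟩
  exact (hz K hK).integrable (by norm_num)

theorem Continuous.memL2loc {m : ℕ} {z : ℝ → EuclideanSpace ℝ (Fin m)} (hz : Continuous z) :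
    MemL2loc z := fun K hK => by
  obtain ⟨C, hC⟩ := hK.exists_bound_of_continuousOn hz.continuousOn
  have : IsFiniteMeasure (volume.restrict K) := ⟨by simpa using hK.measure_lt_top⟩
  exact MemLp.of_bound hz.aestronglyMeasurable C
    ((ae_restrict_iff' hK.measurableSet).2 (Filter.Eventually.of_forall hC))

namespace HasSecondDeriv

variable {m : ℕ} {u v z u' v' z' : ℝ → EuclideanSpace ℝ (Fin m)}

theorem locallyIntegrable (h : HasSecondDeriv u v z) : LocallyIntegrable z :=
  h.memL2loc.locallyIntegrable

theorem continuous_deriv (h : HasSecondDeriv u v z) : Continuous v :=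
  continuous_of_integral_eq_sub h.locallyIntegrable h.integral_eq_sub

theorem continuous (h : HasSecondDeriv u v z) : Continuous u :=
  continuous_iff_continuousAt.2 fun x => (h.hasDerivAt x).continuousAt

theorem integral_deriv_eq_sub (h : HasSecondDeriv u v z) (a b : ℝ) :
    ∫ t in a..b, v t = u b - u a :=
  intervalIntegral.integral_eq_sub_of_hasDerivAt (fun x _ => h.hasDerivAt x)
    (h.continuous_deriv.intervalIntegrable _ _)

theorem isWeakDeriv (h : HasSecondDeriv u v z) : IsWeakDeriv u v :=
  isWeakDeriv_of_integral_eq_sub h.continuous_deriv.locallyIntegrable h.integral_deriv_eq_sub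

theorem isWeakDeriv_deriv (h : HasSecondDeriv u v z) : IsWeakDeriv v z :=
  isWeakDeriv_of_integral_eq_sub h.locallyIntegrable h.integral_eq_sub

theorem memW22loc (h : HasSecondDeriv u v z) : MemW22loc u :=
  ⟨h.continuous, v, z, h.isWeakDeriv, h.isWeakDeriv_deriv, h.continuous_deriv.memL2loc, h.memL2loc⟩

/-- The chosen `weakDeriv` is only determined almost everywhere, and the second one is taken of that
choice, so `z` must first be recognised as a weak derivative of `weakDeriv u`. -/
theorem energy_eq (h : HasSecondDeriv u v z)
    (W : EuclideanSpace ℝ (Fin m) × EuclideanSpace ℝ (Fin m) → ℝ) :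
    energy W u = ∫⁻ x, ENNReal.ofReal (1 / 2 * ‖z x‖ ^ 2 + W (u x, v x)) := by
  have h1 := h.isWeakDeriv.ae_eq_weakDeriv
  refine lintegral_congr_ae ?_
  filter_upwards [h1, (h.isWeakDeriv_deriv.congr h1).ae_eq_weakDeriv] with x hx hx'
  rw [← hx, ← hx']

theorem of_contDiff (hu : ∀ x, HasDerivAt u (v x) x) (hv : ∀ x, HasDerivAt v (z x) x)
    (hz : Continuous z) : HasSecondDeriv u v z :=
  ⟨hu, fun _ _ => intervalIntegral.integral_eq_sub_of_hasDerivAt (fun x _ => hv x)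
    (hz.intervalIntegrable _ _), hz.memL2loc⟩

theorem contDiff_one (h : HasSecondDeriv u v z) : ContDiff ℝ 1 u := by
  rw [contDiff_one_iff_deriv]
  refine ⟨fun x => (h.hasDerivAt x).differentiableAt, ?_⟩
  rw [show deriv u = v from funext fun x => (h.hasDerivAt x).deriv]
  exact h.continuous_deriv

open Classical in
/-- Gluing two functions at a point where they agree to first order. -/
theorem piecewise (h : HasSecondDeriv u v z) (h' : HasSecondDeriv u' v' z') {x₀ : ℝ}
    (hu : u x₀ = u' x₀) (hv : v x₀ = v' x₀) :
    HasSecondDeriv ((Iic x₀).piecewise u u') ((Iic x₀).piecewise v v')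
      ((Iic x₀).piecewise z z') := by
  have hleft : ∀ x ≤ x₀, ∀ f g : ℝ → EuclideanSpace ℝ (Fin m), (Iic x₀).piecewise f g x = f x :=
    fun x hx f g => piecewise_eq_of_mem _ _ _ hx
  have hright : ∀ x ≥ x₀, ∀ f g : ℝ → EuclideanSpace ℝ (Fin m), f x₀ = g x₀ →
      (Iic x₀).piecewise f g x = g x := by
    intro x hx f g hfg
    rcases hx.eq_or_lt with rfl | hx
    · rw [hleft _ le_rfl, hfg]
    · exact piecewise_eq_of_notMem _ _ _ (by simpa using hx)
  refine ⟨fun x => ?_, ?_, fun K hK => ?_⟩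
  · rcases lt_trichotomy x x₀ with hx | rfl | hx
    · rw [hleft _ hx.le]
      refine (h.hasDerivAt x).congr_of_eventuallyEq ?_
      filter_upwards [Iio_mem_nhds hx] with y hy using hleft y hy.le u u'
    · have h1 : HasDerivWithinAt ((Iic x).piecewise u u') ((Iic x).piecewise v v' x) (Iic x) x := by
        rw [hleft _ le_rfl]
        exact (h.hasDerivAt x).hasDerivWithinAt.congr (fun y hy => hleft y hy u u')
          (hleft x le_rfl u u')
      have h2 : HasDerivWithinAt ((Iic x).piecewise u u') ((Iic x).piecewise v v' x) (Ici x) x := by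
        rw [hright _ le_rfl _ _ hv]
        exact (h'.hasDerivAt x).hasDerivWithinAt.congr (fun y hy => hright y hy u u' hu)
          (hright x le_rfl u u' hu)
      simpa using h1.union h2
    · rw [hright _ hx.le _ _ hv]
      refine (h'.hasDerivAt x).congr_of_eventuallyEq ?_
      filter_upwards [Ioi_mem_nhds hx] with y hy using hright y (le_of_lt hy) u u' hu
  -- Integrals based at the gluing point see only one of the two branches.
  · have key : ∀ b, ∫ t in x₀..b, (Iic x₀).piecewise z z' t
        = (Iic x₀).piecewise v v' b - v x₀ := by
      intro b
      rcases le_total b x₀ with hb | hb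
      · rw [hleft _ hb, ← h.integral_eq_sub]
        refine intervalIntegral.integral_congr_ae (Filter.Eventually.of_forall fun t ht => ?_)
        rw [uIoc_of_ge hb] at ht
        exact hleft t ht.2 z z'
      · rw [hright _ hb _ _ hv, hv, ← h'.integral_eq_sub]
        refine intervalIntegral.integral_congr_ae (Filter.Eventually.of_forall fun t ht => ?_)
        rw [uIoc_of_le hb] at ht
        exact piecewise_eq_of_notMem _ _ _ (by simpa using ht.1)
    have hint : LocallyIntegrable ((Iic x₀).piecewise z z') := by
      rw [locallyIntegrable_iff]
      intro K hK
      exact Integrable.piecewise measurableSet_Iic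
        ((h.locallyIntegrable.integrableOn_isCompact hK).integrableOn)
        ((h'.locallyIntegrable.integrableOn_isCompact hK).integrableOn)
    intro a b
    rw [← intervalIntegral.integral_interval_sub_left (hint.intervalIntegrable_real x₀ b)
      (hint.intervalIntegrable_real x₀ a), key, key]
    abel
  · exact MemLp.piecewise measurableSet_Iic ((h.memL2loc K hK).restrict _)
      ((h'.memL2loc K hK).restrict _)

end HasSecondDeriv

/-- The continuous `u` equals a primitive of `u₁` almost everywhere, hence everywhere, and `u₁` has
a continuous representative `v`. So `u` is a primitive of `v`; this already contains the `C¹` claim.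
-/
theorem MemW22loc.exists_hasSecondDeriv {m : ℕ} {u : ℝ → EuclideanSpace ℝ (Fin m)}
    (hu : MemW22loc u) : ∃ v z, HasSecondDeriv u v z := by
  obtain ⟨hc, u₁, u₂, h1, h2, -, hL⟩ := hu
  obtain ⟨v, hv, hvp⟩ := h2.exists_primitive
  obtain ⟨w, hw, hwp⟩ := h1.exists_primitive
  have hwc := continuous_of_integral_eq_sub h1.2.1 hwp
  have hvc := continuous_of_integral_eq_sub h2.2.1 hvp
  obtain rfl : u = w := (hc.ae_eq_iff_eq volume hwc).1 hw
  refine ⟨v, u₂, fun x => ?_, hvp, hL⟩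
  have : u = fun x => u 0 + ∫ t in (0 : ℝ)..x, v t := by
    funext x
    rw [← intervalIntegral.integral_congr_ae (hv.mono fun t ht _ => ht), hwp]
    abel
  have h := (hvc.integral_hasStrictDerivAt 0 x).hasDerivAt.const_add (u 0)
  rwa [← this] at h

/-! ### Quadratic bounds at zeros of a nonnegative `C²` function. -/

section Taylor

variable {E : Type*} [NormedAddCommGroup E] [NormedSpace ℝ E] {W : E → ℝ}

theorem hasDerivAt_comp_line (hW : ContDiff ℝ 2 W) (p w : E) (s : ℝ) :
    HasDerivAt (fun s : ℝ => W (p + s • w)) (fderiv ℝ W (p + s • w) w) s := by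
  have h1 : HasDerivAt (fun s : ℝ => p + s • w) w s := by
    simpa using ((hasDerivAt_id s).smul_const w).const_add p
  exact ((hW.differentiable (by norm_num)) (p + s • w)).hasFDerivAt.comp_hasDerivAt s h1

theorem hasDerivAt_fderiv_comp_line (hW : ContDiff ℝ 2 W) (p w : E) (s : ℝ) :
    HasDerivAt (fun s : ℝ => fderiv ℝ W (p + s • w) w)
      (fderiv ℝ (fderiv ℝ W) (p + s • w) w w) s := by
  have h1 : HasDerivAt (fun s : ℝ => p + s • w) w s := by
    simpa using ((hasDerivAt_id s).smul_const w).const_add p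
  have h2 : ContDiff ℝ 1 (fderiv ℝ W) := hW.fderiv_right (by norm_num)
  have h3 := ((h2.differentiable (by norm_num)) (p + s • w)).hasFDerivAt.comp_hasDerivAt s h1
  simpa using h3.clm_apply (hasDerivAt_const s w)

theorem iteratedDeriv_two_comp_line (hW : ContDiff ℝ 2 W) (p w : E) (s : ℝ) :
    iteratedDeriv 2 (fun s : ℝ => W (p + s • w)) s = fderiv ℝ (fderiv ℝ W) (p + s • w) w w := by
  rw [iteratedDeriv_succ, iteratedDeriv_one]
  rw [show deriv (fun s : ℝ => W (p + s • w)) = fun s => fderiv ℝ W (p + s • w) w from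
    funext fun s => (hasDerivAt_comp_line hW p w s).deriv]
  exact (hasDerivAt_fderiv_comp_line hW p w s).deriv

/-- Second order Taylor formula at a zero of a nonnegative function. -/
theorem exists_eq_half_second_deriv (hW : ContDiff ℝ 2 W) (hW0 : ∀ p, 0 ≤ W p) {p : E}
    (hp : W p = 0) (w : E) :
    ∃ ξ ∈ Icc (0 : ℝ) 1, W (p + w) = 1 / 2 * fderiv ℝ (fderiv ℝ W) (p + ξ • w) w w := by
  set φ : ℝ → ℝ := fun s => W (p + s • w) with hφ
  -- A zero of a nonnegative function is a minimum, so the first-order term drops out.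
  have hd0 : deriv φ 0 = 0 := IsLocalMin.deriv_eq_zero
    (Filter.Eventually.of_forall fun s => by simpa [hφ, hp] using hW0 _)
  have hC : ContDiff ℝ 2 φ := by
    rw [hφ]; fun_prop
  obtain ⟨ξ, hξ, h⟩ := taylor_mean_remainder_lagrange_iteratedDeriv (f := φ) (n := 1)
    (x := 1) (x₀ := 0) zero_ne_one hC.contDiffOn
  rw [uIoo_of_lt one_pos] at hξ
  rw [uIcc_of_le zero_le_one] at h
  refine ⟨ξ, Ioo_subset_Icc_self hξ, ?_⟩
  have hdw : derivWithin φ (Icc 0 1) 0 = 0 := by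
    rw [DifferentiableAt.derivWithin (hC.differentiable (by norm_num) 0)
      (uniqueDiffOn_Icc zero_lt_one 0 (by simp)), hd0]
  rw [taylorWithinEval_succ, taylor_within_zero_eval, iteratedDerivWithin_one, hdw,
    iteratedDeriv_two_comp_line hW] at h
  simp [hφ, hp] at h
  rw [h]; ring

theorem continuous_second_deriv (hW : ContDiff ℝ 2 W) : Continuous (fderiv ℝ (fderiv ℝ W)) :=
  (hW.fderiv_right (m := 1) (by norm_num)).continuous_fderiv (by norm_num)

/-- A nonnegative `C²` function grows at most quadratically near a compact set of zeros. -/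
theorem exists_quadratic_upper_bound [ProperSpace E] (hW : ContDiff ℝ 2 W) (hW0 : ∀ p, 0 ≤ W p)
    {K : Set E} (hK : IsCompact K) (hKW : ∀ p ∈ K, W p = 0) :
    ∃ C > 0, ∀ p ∈ K, ∀ w, ‖w‖ ≤ 1 → W (p + w) ≤ C * ‖w‖ ^ 2 := by
  obtain ⟨C, hC⟩ := (hK.cthickening (r := 1)).exists_bound_of_continuousOn
    (f := fderiv ℝ (fderiv ℝ W)) (continuous_second_deriv hW).continuousOn
  refine ⟨max C 1, by positivity, fun p hp w hw => ?_⟩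
  obtain ⟨ξ, hξ, h⟩ := exists_eq_half_second_deriv hW hW0 (hKW p hp) w
  have hmem : p + ξ • w ∈ Metric.cthickening 1 K := by
    refine Metric.mem_cthickening_of_dist_le _ p _ _ hp ?_
    rw [dist_eq_norm, add_sub_cancel_left, norm_smul, Real.norm_of_nonneg hξ.1]
    nlinarith [hξ.1, hξ.2, norm_nonneg w]
  have h1 := (le_abs_self _).trans
    ((fderiv ℝ (fderiv ℝ W) (p + ξ • w)).le_opNorm₂ w w)
  have h2 := (hC _ hmem).trans (le_max_left C 1)
  rw [h]
  nlinarith [mul_le_mul_of_nonneg_right h2 (sq_nonneg ‖w‖), sq_nonneg ‖w‖,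
    le_max_right C 1, mul_nonneg (zero_le_one.trans (le_max_right C 1)) (sq_nonneg ‖w‖)]

/-- Positivity of the second derivative along a compact family of directions at zeros of a
nonnegative function gives quadratic growth in these directions. -/
theorem exists_quadratic_lower_bound (hW : ContDiff ℝ 2 W) (hW0 : ∀ p, 0 ≤ W p)
    {N : Set (E × E)} (hN : IsCompact N) (hNW : ∀ x ∈ N, W x.1 = 0)
    (hpos : ∀ x ∈ N, 0 < fderiv ℝ (fderiv ℝ W) x.1 x.2 x.2) :
    ∃ c > 0, ∃ r > 0, ∀ x ∈ N, ∀ s ∈ Icc 0 r, c * s ^ 2 ≤ W (x.1 + s • x.2) := by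
  set f : (E × E) × ℝ → ℝ := fun y =>
    fderiv ℝ (fderiv ℝ W) (y.1.1 + y.2 • y.1.2) y.1.2 y.1.2 with hf
  have hfc : Continuous f := by
    have := continuous_second_deriv hW
    have h1 : Continuous fun y : (E × E) × ℝ => fderiv ℝ (fderiv ℝ W) (y.1.1 + y.2 • y.1.2) :=
      this.comp (by fun_prop)
    exact (h1.clm_apply (by fun_prop)).clm_apply (by fun_prop)
  -- Compactness of `N` makes the length `r`, on which the second derivative stays positive, uniform
  -- in the base point and the direction.
  obtain ⟨U, V, hU, hV, hNU, hV0, hUV⟩ := generalized_tube_lemma hN (isCompact_singleton (x := (0 : ℝ)))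
    (isOpen_lt continuous_const hfc : IsOpen {y | 0 < f y}) (by
      rintro ⟨x, s⟩ ⟨hx, hs⟩
      obtain rfl : s = 0 := hs
      simpa [hf] using hpos x hx)
  obtain ⟨r, hr, hrV⟩ := Metric.nhds_basis_closedBall.mem_iff.1 (hV.mem_nhds (hV0 rfl))
  have hcomp : IsCompact (N ×ˢ Icc (0 : ℝ) r) := hN.prod isCompact_Icc
  have hfpos : ∀ y ∈ N ×ˢ Icc (0 : ℝ) r, 0 < f y := fun y hy =>
    hUV ⟨hNU hy.1, hrV (by
      rw [Metric.mem_closedBall, dist_zero_right, Real.norm_of_nonneg hy.2.1]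
      exact hy.2.2)⟩
  obtain ⟨c, hc, hcf⟩ := hcomp.exists_forall_le' hfc.continuousOn hfpos
  refine ⟨c / 2, by positivity, r, hr, fun x hx s hs => ?_⟩
  obtain ⟨ξ, hξ, h⟩ := exists_eq_half_second_deriv hW hW0 (hNW x hx) (s • x.2)
  have h1 := hcf (x, ξ * s) ⟨hx, mul_nonneg hξ.1 hs.1, by nlinarith [hξ.1, hξ.2, hs.1, hs.2]⟩
  rw [h]
  simp only [hf] at h1
  simp only [map_smul, smul_smul, smul_apply, smul_eq_mul]
  nlinarith [mul_le_mul_of_nonneg_right h1 (sq_nonneg s)]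

end Taylor

/-! ### Growth of `W` in the normal directions of the hypersurface. -/

/-- The vector from a point to its nearest point on a hypersurface is normal. -/
theorem exists_smul_normal_eq_sub {m : ℕ} {S : Set (EuclideanSpace ℝ (Fin m))}
    (hS : IsC2Hypersurface S) {n : EuclideanSpace ℝ (Fin m) → EuclideanSpace ℝ (Fin m)}
    (hn : IsUnitNormalField S n) {u a : EuclideanSpace ℝ (Fin m)} (ha : a ∈ S)
    (hua : ∀ b ∈ S, dist u a ≤ dist u b) : ∃ β : ℝ, u - a = β • n a := by
  obtain ⟨U, g, haU, hg⟩ := hS a ha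
  have hker := (hn.2 a ha).2 U g haU hg
  have hn1 := (hn.2 a ha).1
  obtain ⟨hU, hgC, hg0, hgS⟩ := hg
  have hga : g a = 0 := (hgS a haU).1 ha
  have hUa : U ∈ nhds a := hU.mem_nhds haU
  have hstrict : HasStrictFDerivAt g (fderiv ℝ g a) a :=
    (hgC.contDiffAt hUa).hasStrictFDerivAt (by norm_num)
  have hφ : HasStrictFDerivAt (fun x => ‖x - u‖ ^ 2)
      (2 • (innerSL ℝ (a - u)).comp (ContinuousLinearMap.id ℝ _)) a :=
    (hasStrictFDerivAt_norm_sq (a - u)).comp a ((hasStrictFDerivAt_id a).sub_const u)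
  have hext : IsLocalExtrOn (fun x => ‖x - u‖ ^ 2) {x | g x = g a} a := by
    left
    filter_upwards [mem_nhdsWithin_of_mem_nhds hUa, self_mem_nhdsWithin] with x hx hx'
    have hxS : x ∈ S := (hgS x hx).2 (by rw [← hga]; exact hx')
    have := hua x hxS
    rw [dist_comm u, dist_comm u, dist_eq_norm, dist_eq_norm] at this
    gcongr
  -- Lagrange multipliers for the squared distance to `u` under the constraint `g = 0`; `μ ≠ 0`
  -- because `dg` does not vanish.
  obtain ⟨l, μ, hne, hlm⟩ := hext.exists_multipliers_of_hasStrictFDerivAt_1d hstrict hφ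
  have hμ : μ ≠ 0 := by
    rintro rfl
    have : l • fderiv ℝ g a = 0 := by simpa using hlm
    rcases smul_eq_zero.1 this with h | h
    · exact hne (by rw [h]; rfl)
    · exact hg0 a haU h
  have horth : ∀ w, fderiv ℝ g a w = 0 → ⟪u - a, w⟫ = 0 := by
    intro w hw
    have := congrArg (fun T : StrongDual ℝ (EuclideanSpace ℝ (Fin m)) => T w) hlm
    simp [hw, hμ] at this
    rw [← neg_sub, inner_neg_left]
    simp [inner_sub_left, this]
  have hgn : fderiv ℝ g a (n a) ≠ 0 := by
    intro h
    have := hker _ h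
    rw [real_inner_self_eq_norm_sq, hn1] at this
    norm_num at this
  -- This `β` makes `u - a - β n` tangent; both `u - a` and `n` are orthogonal to tangent vectors,
  -- so the difference is orthogonal to itself.
  set β := fderiv ℝ g a (u - a) / fderiv ℝ g a (n a) with hβ
  have hw : fderiv ℝ g a (u - a - β • n a) = 0 := by
    rw [map_sub, map_smul, smul_eq_mul, hβ, div_mul_cancel₀ _ hgn, sub_self]
  refine ⟨β, sub_eq_zero.1 (inner_self_eq_zero (𝕜 := ℝ).1 ?_)⟩
  rw [inner_sub_left, inner_smul_left, horth _ hw, hker _ hw]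
  simp

/-- Quadratic growth of `W` near `S × {0}` when it is nondegenerate in the normal directions. -/
theorem exists_nondegenerate_lower_bound {m : ℕ}
    {W : EuclideanSpace ℝ (Fin m) × EuclideanSpace ℝ (Fin m) → ℝ}
    (hW : ContDiff ℝ 2 W) (hW0 : ∀ p, 0 ≤ W p) {S : Set (EuclideanSpace ℝ (Fin m))}
    (hSne : S.Nonempty) (hSc : IsCompact S) (hSW : ∀ a ∈ S, W (a, 0) = 0)
    (hS : IsC2Hypersurface S)
    {n : EuclideanSpace ℝ (Fin m) → EuclideanSpace ℝ (Fin m)} (hn : IsUnitNormalField S n)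
    (hnondeg : ∀ a ∈ S, ∀ (α : ℝ) (ν : EuclideanSpace ℝ (Fin m)), α ^ 2 + ‖ν‖ ^ 2 = 1 →
      0 < iteratedDeriv 2 (fun s : ℝ => W (a + s • α • n a, s • ν)) 0) :
    ∃ c > 0, ∃ r > 0, ∀ u v, Metric.infDist u S ≤ r → ‖v‖ ≤ r →
      c * (Metric.infDist u S ^ 2 + ‖v‖ ^ 2) ≤ W (u, v) := by
  set B : Set (ℝ × EuclideanSpace ℝ (Fin m)) := {y | y.1 ^ 2 + ‖y.2‖ ^ 2 = 1} with hB
  have hBc : IsCompact B := by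
    refine Metric.isCompact_of_isClosed_isBounded
      (isClosed_eq (by fun_prop) continuous_const) ?_
    refine (Metric.isBounded_closedBall (x := (0 : ℝ × EuclideanSpace ℝ (Fin m))) (r := 1)).subset ?_
    intro y hy
    rw [hB, mem_ofPred_eq] at hy
    rw [Metric.mem_closedBall, dist_zero_right, Prod.norm_def]
    refine max_le ?_ ?_
    · rw [Real.norm_eq_abs]; exact abs_le_one_iff_mul_self_le_one.2 (by nlinarith [sq_nonneg ‖y.2‖])
    · nlinarith [sq_nonneg y.1, norm_nonneg y.2]
  set ι : EuclideanSpace ℝ (Fin m) × (ℝ × EuclideanSpace ℝ (Fin m)) →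
      (EuclideanSpace ℝ (Fin m) × EuclideanSpace ℝ (Fin m)) ×
        (EuclideanSpace ℝ (Fin m) × EuclideanSpace ℝ (Fin m)) :=
    fun y => ((y.1, 0), (y.2.1 • n y.1, y.2.2)) with hι
  have hιc : ContinuousOn ι (S ×ˢ B) := by
    have h1 : ContinuousOn (fun y : EuclideanSpace ℝ (Fin m) × (ℝ × EuclideanSpace ℝ (Fin m)) =>
        n y.1) (S ×ˢ B) := hn.1.comp continuousOn_fst fun y hy => hy.1
    have h2 : ContinuousOn (fun y : EuclideanSpace ℝ (Fin m) × (ℝ × EuclideanSpace ℝ (Fin m)) =>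
        y.2.1 • n y.1) (S ×ˢ B) := ContinuousOn.smul continuous_snd.fst.continuousOn h1
    exact (continuous_fst.prodMk continuous_const).continuousOn.prodMk
      (h2.prodMk continuous_snd.snd.continuousOn)
  obtain ⟨c, hc, r, hr, hlow⟩ := exists_quadratic_lower_bound hW hW0
    ((hSc.prod hBc).image_of_continuousOn hιc)
    (by rintro _ ⟨y, hy, rfl⟩; exact hSW _ hy.1)
    (by
      rintro _ ⟨⟨a, α, ν⟩, hy, rfl⟩
      have h := hnondeg a hy.1 α ν hy.2
      have h2 := iteratedDeriv_two_comp_line hW (a, (0 : EuclideanSpace ℝ (Fin m))) (α • n a, ν) 0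
      simp only [Prod.smul_mk, Prod.mk_add_mk, zero_add, zero_smul, add_zero] at h2
      rw [h2] at h
      simpa [hι] using h)
  -- With both quantities at most `r / 2`, the length `s` of `(β, v)` is at most `r`, and `(β, v) /
  -- s` is an admissible unit direction.
  refine ⟨c, hc, r / 2, by positivity, fun u v hu hv => ?_⟩
  obtain ⟨a, ha, hua⟩ := hSc.exists_infDist_eq_dist hSne u
  obtain ⟨β, hβ⟩ := exists_smul_normal_eq_sub hS hn ha fun b hb =>
    hua ▸ Metric.infDist_le_dist_of_mem hb
  have hd : Metric.infDist u S ^ 2 = β ^ 2 := by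
    rw [hua, dist_eq_norm, hβ, norm_smul, (hn.2 a ha).1, mul_one, Real.norm_eq_abs, sq_abs]
  have hu' : u = a + β • n a := by rw [← hβ]; abel
  set s := Real.sqrt (β ^ 2 + ‖v‖ ^ 2) with hs
  have hs2 : s ^ 2 = β ^ 2 + ‖v‖ ^ 2 := Real.sq_sqrt (by positivity)
  rw [hd]
  rcases eq_or_lt_of_le (Real.sqrt_nonneg (β ^ 2 + ‖v‖ ^ 2)) with h0 | hspos
  · rw [← hs2, hs, ← h0]; simpa using hW0 _
  · rw [← hs] at hspos
    have hsr : s ≤ r := by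
      rw [hs, Real.sqrt_le_left hr.le, ← hd]
      nlinarith [Metric.infDist_nonneg (x := u) (s := S), norm_nonneg v]
    have := hlow (ι (a, (β / s, s⁻¹ • v))) ⟨_, ⟨ha, ?_⟩, rfl⟩ s ⟨hspos.le, hsr⟩
    · rw [hs2] at this
      refine this.trans (le_of_eq ?_)
      congr 1
      simp only [hι, Prod.smul_mk, Prod.mk_add_mk, zero_add, smul_smul]
      rw [mul_div_cancel₀ _ hspos.ne', mul_inv_cancel₀ hspos.ne', one_smul, ← hu']
    · simp only [hB, mem_ofPred_eq, norm_smul, norm_inv, Real.norm_of_nonneg hspos.le]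
      field_simp
      rw [hs2]

/-! ### Competitors: transition maps and cubic arcs. -/

theorem hasSecondDeriv_const {m : ℕ} (a : EuclideanSpace ℝ (Fin m)) :
    HasSecondDeriv (fun _ => a) (fun _ => 0) (fun _ => 0) :=
  .of_contDiff (fun x => hasDerivAt_const x a) (fun x => hasDerivAt_const x 0) continuous_const

/-- Two zeros of `W(·, 0)` are joined by a path of finite energy which is constant outside a compact
interval. -/
theorem exists_admissible_energy_ne_top {m : ℕ}
    {W : EuclideanSpace ℝ (Fin m) × EuclideanSpace ℝ (Fin m) → ℝ} (hW : Continuous W)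
    {Am Ap : Set (EuclideanSpace ℝ (Fin m))} {q : ℝ} (hq : 0 < q)
    {a b : EuclideanSpace ℝ (Fin m)} (ha : a ∈ Am) (hb : b ∈ Ap)
    (hWa : W (a, 0) = 0) (hWb : W (b, 0) = 0) :
    ∃ w ∈ admissible Am Ap q, energy W w ≠ ⊤ := by
  set S := Real.smoothTransition
  have hS : ContDiff ℝ 2 S := Real.smoothTransition.contDiff
  have hS1 : ContDiff ℝ 1 (deriv S) := hS.deriv'
  have hd1 : ∀ x, HasDerivAt S (deriv S x) x := fun x =>
    (hS.differentiable (by norm_num) x).hasDerivAt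
  have hd2 : ∀ x, HasDerivAt (deriv S) (deriv (deriv S) x) x := fun x =>
    (hS1.differentiable (by norm_num) x).hasDerivAt
  have hc2 : Continuous (deriv (deriv S)) := hS1.continuous_deriv le_rfl
  have hsec : HasSecondDeriv (fun x => a + S x • (b - a)) (fun x => deriv S x • (b - a))
      (fun x => deriv (deriv S) x • (b - a)) :=
    .of_contDiff (fun x => ((hd1 x).smul_const _).const_add a)
      (fun x => (hd2 x).smul_const _) (by fun_prop)
  have hneg : ∀ x < 0, S x = 0 ∧ deriv S x = 0 ∧ deriv (deriv S) x = 0 := by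
    intro x hx
    have h1 : S =ᶠ[nhds x] fun _ => (0 : ℝ) := by
      filter_upwards [Iio_mem_nhds hx] with y hy
        using Real.smoothTransition.zero_of_nonpos (le_of_lt hy)
    refine ⟨h1.eq_of_nhds, ?_, ?_⟩
    · rw [h1.deriv_eq]; simp
    · rw [h1.deriv.deriv_eq]; simp
  have hpos : ∀ x > 1, S x = 1 ∧ deriv S x = 0 ∧ deriv (deriv S) x = 0 := by
    intro x hx
    have h1 : S =ᶠ[nhds x] fun _ => (1 : ℝ) := by
      filter_upwards [Ioi_mem_nhds hx] with y hy
        using Real.smoothTransition.one_of_one_le (le_of_lt hy)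
    refine ⟨h1.eq_of_nhds, ?_, ?_⟩
    · rw [h1.deriv_eq]; simp
    · rw [h1.deriv.deriv_eq]; simp
  refine ⟨_, ⟨hsec.memW22loc, -1, 2, by norm_num, fun x hx => ?_, fun x hx => ?_⟩, ?_⟩
  · have := (hneg x (by linarith)).1
    simp only [this, zero_smul, add_zero, Metric.infDist_zero_of_mem ha, hq.le]
  · have := (hpos x (by linarith)).1
    simp only [this, one_smul, add_sub_cancel, Metric.infDist_zero_of_mem hb, hq.le]
  · rw [hsec.energy_eq]
    refine (Integrable.lintegral_lt_top ?_).ne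
    refine Continuous.integrable_of_hasCompactSupport ?_
      (HasCompactSupport.intro (isCompact_Icc (a := (0 : ℝ)) (b := 1)) fun x hx => ?_)
    · have := hsec.continuous
      have := hsec.continuous_deriv
      fun_prop
    · rcases lt_or_ge x 0 with h | h
      · simp [hneg x h, hWa]
      · simp [hpos x (by by_contra hcon; exact hx ⟨h, not_lt.1 hcon⟩), hWb]

/-- A cubic arc, on an interval of length one, from rest at `a` to prescribed position and
velocity, is bounded in `C²` by the distance of these data from rest at `a`. -/
theorem exists_hermite_arc {m : ℕ} (a p₁ v₁ : EuclideanSpace ℝ (Fin m)) (x₀ : ℝ) :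
    ∃ p p' p'' : ℝ → EuclideanSpace ℝ (Fin m), HasSecondDeriv p p' p'' ∧
      p (x₀ - 1) = a ∧ p' (x₀ - 1) = 0 ∧ p x₀ = p₁ ∧ p' x₀ = v₁ ∧
      ∀ t ∈ Icc (x₀ - 1) x₀, ‖p t - a‖ ≤ ‖p₁ - a‖ + ‖v₁‖ ∧
        ‖p' t‖ ≤ 2 * (‖p₁ - a‖ + ‖v₁‖) ∧ ‖p'' t‖ ≤ 6 * (‖p₁ - a‖ + ‖v₁‖) := by
  have hs : ∀ t, HasDerivAt (fun t => t - x₀ + 1) 1 t := fun t =>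
    ((hasDerivAt_id t).sub_const x₀).add_const 1
  have bound : ∀ (α β k : ℝ), |α| ≤ k → |β| ≤ k →
      ‖α • (p₁ - a) + β • v₁‖ ≤ k * (‖p₁ - a‖ + ‖v₁‖) := by
    intro α β k hα hβ
    refine (norm_add_le _ _).trans ?_
    rw [norm_smul, norm_smul, Real.norm_eq_abs, Real.norm_eq_abs, mul_add]
    gcongr
  -- Hermite interpolation in `s = t - x₀ + 1 ∈ [0, 1]`: `3s² - 2s³` carries the final position and
  -- `s³ - s²` the final velocity.
  refine ⟨fun t => a + ((3 * (t - x₀ + 1) ^ 2 - 2 * (t - x₀ + 1) ^ 3) • (p₁ - a)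
      + ((t - x₀ + 1) ^ 3 - (t - x₀ + 1) ^ 2) • v₁),
    fun t => (6 * (t - x₀ + 1) - 6 * (t - x₀ + 1) ^ 2) • (p₁ - a)
      + (3 * (t - x₀ + 1) ^ 2 - 2 * (t - x₀ + 1)) • v₁,
    fun t => (6 - 12 * (t - x₀ + 1)) • (p₁ - a) + (6 * (t - x₀ + 1) - 2) • v₁,
    .of_contDiff (fun t => ?_) (fun t => ?_) (by fun_prop), by simp, by simp, by norm_num,
    by norm_num, fun t ht => ?_⟩
  · refine HasDerivAt.const_add a (HasDerivAt.add (HasDerivAt.smul_const ?_ _)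
      (HasDerivAt.smul_const ?_ _))
    · exact ((((hs t).pow 2).const_mul 3).sub (((hs t).pow 3).const_mul 2)).congr_deriv (by push_cast; ring)
    · exact (((hs t).pow 3).sub ((hs t).pow 2)).congr_deriv (by push_cast; ring)
  · refine HasDerivAt.add (HasDerivAt.smul_const ?_ _) (HasDerivAt.smul_const ?_ _)
    · exact (((hs t).const_mul 6).sub (((hs t).pow 2).const_mul 6)).congr_deriv (by push_cast; ring)
    · exact ((((hs t).pow 2).const_mul 3).sub ((hs t).const_mul 2)).congr_deriv (by push_cast; ring)
  · simp only [add_sub_cancel_left]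
    set s := t - x₀ + 1
    have h0 : 0 ≤ s := by simp only [s]; linarith [ht.1]
    have h1 : s ≤ 1 := by simp only [s]; linarith [ht.2]
    have h2 : 0 ≤ s * (1 - s) := mul_nonneg h0 (by linarith)
    have h3 : 0 ≤ s ^ 2 * (1 - s) := mul_nonneg (sq_nonneg s) (by linarith)
    have h4 : 0 ≤ s * (1 - s) ^ 2 := mul_nonneg h0 (sq_nonneg _)
    refine ⟨(bound _ _ 1 ?_ ?_).trans_eq (one_mul _), bound _ _ 2 ?_ ?_, bound _ _ 6 ?_ ?_⟩ <;>
      rw [abs_le] <;> constructor <;> nlinarith [sq_nonneg (s - 1 / 2), sq_nonneg s]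

/-! ### Comparison of a minimizer with the cubic arc. -/

section Energy

variable {m : ℕ} {W : EuclideanSpace ℝ (Fin m) × EuclideanSpace ℝ (Fin m) → ℝ}
  {u v z : ℝ → EuclideanSpace ℝ (Fin m)}

theorem HasSecondDeriv.integrable_density (h : HasSecondDeriv u v z) (hW : Continuous W)
    (hW0 : ∀ p, 0 ≤ W p) (hfin : energy W u ≠ ⊤) :
    Integrable fun x => 1 / 2 * ‖z x‖ ^ 2 + W (u x, v x) := by
  have hm : AEStronglyMeasurable (fun x => 1 / 2 * ‖z x‖ ^ 2 + W (u x, v x)) volume := by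
    have h1 := h.locallyIntegrable.aestronglyMeasurable
    have h2 : Continuous fun x => W (u x, v x) :=
      hW.comp (h.continuous.prodMk h.continuous_deriv)
    exact ((h1.norm.pow 2).const_mul _).add h2.aestronglyMeasurable
  refine (lintegral_ofReal_ne_top_iff_integrable hm (Filter.Eventually.of_forall fun x => ?_)).1
    (h.energy_eq W ▸ hfin)
  have := hW0 (u x, v x)
  simp only [Pi.zero_apply]
  positivity

/-- Comparison of a minimizer with the map which comes to `u x₀` along a cubic arc from rest at a
point of `Am`. -/
theorem IsMinimizer.setIntegral_Iic_density_le {Am Ap : Set (EuclideanSpace ℝ (Fin m))} {q : ℝ}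
    (hu : IsMinimizer W Am Ap q u) (h : HasSecondDeriv u v z) (hW : Continuous W)
    (hW0 : ∀ p, 0 ≤ W p) (hq : 0 < q) (hfin : energy W u ≠ ⊤) {C : ℝ}
    {a : EuclideanSpace ℝ (Fin m)} (ha : a ∈ Am) (hWa : W (a, 0) = 0)
    (hC : ∀ w, ‖w‖ ≤ 1 → W ((a, 0) + w) ≤ C * ‖w‖ ^ 2) (hC0 : 0 < C)
    {xp x₀ : ℝ} (hxp : ∀ x ≥ xp, Metric.infDist (u x) Ap ≤ q)
    (hD : ‖u x₀ - a‖ + ‖v x₀‖ ≤ 1 / 2) :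
    ∫ x in Iic x₀, (1 / 2 * ‖z x‖ ^ 2 + W (u x, v x)) ≤
      (18 + 4 * C) * (‖u x₀ - a‖ + ‖v x₀‖) ^ 2 := by
  classical
  set D := ‖u x₀ - a‖ + ‖v x₀‖ with hDdef
  have hDn : 0 ≤ D := by positivity
  obtain ⟨p, p', p'', hp, hp0, hp0', hp1, hp1', hpb⟩ := exists_hermite_arc a (u x₀) (v x₀) x₀
  have hmem : x₀ ∉ Iic (x₀ - 1) := by simp
  have hw := ((hasSecondDeriv_const a).piecewise hp hp0.symm hp0'.symm).piecewise h (x₀ := x₀)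
    (by rw [piecewise_eq_of_notMem _ _ _ hmem, hp1])
    (by rw [piecewise_eq_of_notMem _ _ _ hmem, hp1'])
  set w := (Iic x₀).piecewise ((Iic (x₀ - 1)).piecewise (fun _ => a) p) u
  set w' := (Iic x₀).piecewise ((Iic (x₀ - 1)).piecewise (fun _ => 0) p') v
  set w'' := (Iic x₀).piecewise ((Iic (x₀ - 1)).piecewise (fun _ => 0) p'') z
  have hadm : w ∈ admissible Am Ap q := by
    refine ⟨hw.memW22loc, x₀ - 1, max x₀ xp + 1, ?_, fun x hx => ?_, fun x hx => ?_⟩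
    · linarith [le_max_left x₀ xp]
    · simp only [w]
      rw [piecewise_eq_of_mem _ _ _ (by simp only [mem_Iic]; linarith),
        piecewise_eq_of_mem _ _ _ (by simpa using hx), Metric.infDist_zero_of_mem ha]
      exact hq.le
    · simp only [w]
      rw [piecewise_eq_of_notMem _ _ _ (by simp only [mem_Iic]; linarith [le_max_left x₀ xp])]
      exact hxp x (by linarith [le_max_right x₀ xp])
  have hle := hu.2 w hadm
  rw [h.energy_eq, hw.energy_eq] at hle
  rw [h.energy_eq] at hfin
  rw [← lintegral_add_compl _ (measurableSet_Iic (a := x₀)),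
    ← lintegral_add_compl (fun x => ENNReal.ofReal (1 / 2 * ‖w'' x‖ ^ 2 + W (w x, w' x)))
      (measurableSet_Iic (a := x₀))] at hle
  have hcompl : ∫⁻ x in (Iic x₀)ᶜ, ENNReal.ofReal (1 / 2 * ‖w'' x‖ ^ 2 + W (w x, w' x)) =
      ∫⁻ x in (Iic x₀)ᶜ, ENNReal.ofReal (1 / 2 * ‖z x‖ ^ 2 + W (u x, v x)) := by
    refine setLIntegral_congr_fun measurableSet_Iic.compl fun x hx => ?_
    simp only [w, w', w'', piecewise_eq_of_notMem _ _ _ hx]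
  -- Finiteness is what allows the common energy on `x > x₀` to be cancelled in `[0, ∞]`.
  have hcfin : ∫⁻ x in (Iic x₀)ᶜ, ENNReal.ofReal (1 / 2 * ‖z x‖ ^ 2 + W (u x, v x)) ≠ ⊤ :=
    ne_top_of_le_ne_top hfin (setLIntegral_le_lintegral _ _)
  rw [hcompl] at hle
  have hle := (ENNReal.add_le_add_iff_right hcfin).1 hle
  have hbound : ∫⁻ x in Iic x₀, ENNReal.ofReal (1 / 2 * ‖w'' x‖ ^ 2 + W (w x, w' x)) ≤
      ENNReal.ofReal ((18 + 4 * C) * D ^ 2) := by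
    calc ∫⁻ x in Iic x₀, ENNReal.ofReal (1 / 2 * ‖w'' x‖ ^ 2 + W (w x, w' x))
        ≤ ∫⁻ x in Iic x₀, (Ioc (x₀ - 1) x₀).indicator
            (fun _ => ENNReal.ofReal ((18 + 4 * C) * D ^ 2)) x := by
          refine setLIntegral_mono' measurableSet_Iic fun x hx => ?_
          simp only [w, w', w'', piecewise_eq_of_mem _ _ _ hx]
          rcases le_or_gt x (x₀ - 1) with h1 | h1
          · have h1 : x ∈ Iic (x₀ - 1) := h1
            simp [piecewise_eq_of_mem _ _ _ h1, hWa]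
          · have h1' : x ∉ Iic (x₀ - 1) := not_le.2 h1
            have h2 : x ∈ Ioc (x₀ - 1) x₀ := ⟨h1, hx⟩
            simp only [piecewise_eq_of_notMem _ _ _ h1', indicator_of_mem h2]
            refine ENNReal.ofReal_le_ofReal ?_
            obtain ⟨b1, b2, b3⟩ := hpb x ⟨h1.le, hx⟩
            rw [← hDdef] at b1 b2 b3
            -- As `D ≤ 1 / 2`, this displacement is within the range of `hC`. The constant is `(6D)²
            -- / 2 + C (2D)² = (18 + 4C) D²`, on an interval of length one.
            have hn : ‖(p x - a, p' x)‖ ≤ 2 * D := by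
              rw [Prod.norm_def]
              exact max_le (b1.trans (by linarith)) b2
            have := hC (p x - a, p' x) (hn.trans (by linarith))
            rw [Prod.mk_add_mk, add_sub_cancel, zero_add] at this
            have h3 : ‖(p x - a, p' x)‖ ^ 2 ≤ (2 * D) ^ 2 := by gcongr
            have h4 : ‖p'' x‖ ^ 2 ≤ (6 * D) ^ 2 := by gcongr
            nlinarith [mul_le_mul_of_nonneg_left h3 hC0.le]
      _ ≤ ∫⁻ x, (Ioc (x₀ - 1) x₀).indicator
            (fun _ => ENNReal.ofReal ((18 + 4 * C) * D ^ 2)) x := setLIntegral_le_lintegral _ _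
      _ = ENNReal.ofReal ((18 + 4 * C) * D ^ 2) := by
          rw [lintegral_indicator_const measurableSet_Ioc, Real.volume_Ioc]
          simp
  have hint := h.integrable_density hW hW0 (by rwa [h.energy_eq])
  rw [← ENNReal.ofReal_le_ofReal_iff (by positivity),
    ofReal_integral_eq_lintegral_ofReal hint.integrableOn
      (Filter.Eventually.of_forall fun x => ?_)]
  · exact hle.trans hbound
  · have := hW0 (u x, v x)
    simp only [Pi.zero_apply]
    positivity

end Energy

/-! ### Gronwall argument for the energy of a half line. -/

open Filter Topology

theorem intervalIntegral_le_setIntegral_Iic {f : ℝ → ℝ} (hf : Integrable f) (hf0 : ∀ x, 0 ≤ f x)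
    {a b c : ℝ} (hab : a ≤ b) (hbc : b ≤ c) : ∫ t in a..b, f t ≤ ∫ t in Iic c, f t := by
  rw [intervalIntegral.integral_of_le hab]
  exact setIntegral_mono_set hf.integrableOn (Eventually.of_forall hf0)
    (LE.le.eventuallyLE fun x hx => hx.2.trans hbc)

theorem setIntegral_Iic_mono {f : ℝ → ℝ} (hf : Integrable f) (hf0 : ∀ x, 0 ≤ f x)
    {a b : ℝ} (hab : a ≤ b) : ∫ t in Iic a, f t ≤ ∫ t in Iic b, f t :=
  setIntegral_mono_set hf.integrableOn (Eventually.of_forall hf0)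
    (LE.le.eventuallyLE (Iic_subset_Iic.2 hab))

/-- If the integral over `(-∞, x]` of a nonnegative function is controlled by a continuous minorant
at `x`, then it decays exponentially as `x → -∞`. -/
theorem exists_exp_bound_setIntegral_Iic {e h : ℝ → ℝ} (he : Integrable e) (hh : Continuous h)
    (hh0 : ∀ x, 0 ≤ h x) (hhe : ∀ x, h x ≤ e x) {C x₁ : ℝ} (hC : 0 < C)
    (hle : ∀ x ≤ x₁, ∫ t in Iic x, e t ≤ C * h x) :
    ∃ K > 0, ∀ x ≤ x₁ - 1, ∫ t in Iic x, e t ≤ K * Real.exp (C⁻¹ * x) := by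
  have he0 : ∀ x, 0 ≤ e x := fun x => (hh0 x).trans (hhe x)
  have hhi : Integrable h := he.mono' hh.aestronglyMeasurable
    (Eventually.of_forall fun x => by rw [Real.norm_of_nonneg (hh0 x)]; exact hhe x)
  -- Since `e` is merely integrable, Gronwall is run on the integral of the continuous minorant,
  -- which is differentiable everywhere and satisfies `H ≤ C H'`.
  set H : ℝ → ℝ := fun x => ∫ t in Iic x, h t with hH
  have hHd : ∀ x, HasDerivAt H (h x) x := by
    intro x
    have h1 : H = fun x => H 0 + ∫ t in (0 : ℝ)..x, h t := by
      funext y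
      rw [← intervalIntegral.integral_Iic_sub_Iic hhi.integrableOn hhi.integrableOn]
      simp only [hH]; ring
    have h2 := (hh.integral_hasStrictDerivAt 0 x).hasDerivAt.const_add (H 0)
    rwa [← h1] at h2
  have hHE : ∀ x ≤ x₁, H x ≤ C * h x := fun x hx =>
    (setIntegral_mono hhi.integrableOn he.integrableOn hhe).trans (hle x hx)
  set G : ℝ → ℝ := fun x => H x * Real.exp (-(C⁻¹ * x)) with hG
  have hGd : ∀ x, HasDerivAt G ((h x - C⁻¹ * H x) * Real.exp (-(C⁻¹ * x))) x := by
    intro x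
    have h1 : HasDerivAt (fun x => -(C⁻¹ * x)) (-C⁻¹) x := by
      exact ((hasDerivAt_id x).const_mul C⁻¹).neg.congr_deriv (by simp)
    exact ((hHd x).mul h1.exp).congr_deriv (by ring)
  have hGm : MonotoneOn G (Iic x₁) := by
    refine monotoneOn_of_deriv_nonneg (convex_Iic x₁)
      (fun x _ => (hGd x).continuousAt.continuousWithinAt)
      (fun x _ => (hGd x).differentiableAt.differentiableWithinAt) fun x hx => ?_
    rw [interior_Iic] at hx
    rw [(hGd x).deriv]
    refine mul_nonneg ?_ (Real.exp_pos _).le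
    have := hHE x (le_of_lt hx)
    rw [sub_nonneg, inv_mul_le_iff₀ hC]
    exact this
  have hHexp : ∀ x ≤ x₁, H x ≤ G x₁ * Real.exp (C⁻¹ * x) := by
    intro x hx
    have := hGm (mem_Iic.2 hx) (mem_Iic.2 le_rfl) hx
    calc H x = G x * Real.exp (C⁻¹ * x) := by
          simp only [hG]; rw [mul_assoc, ← Real.exp_add]; simp
      _ ≤ _ := by gcongr
  have hG0 : 0 ≤ G x₁ :=
    mul_nonneg (setIntegral_nonneg measurableSet_Iic fun x _ => hh0 x) (Real.exp_pos _).le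
  refine ⟨C * (G x₁ * Real.exp C⁻¹) + 1, by positivity, fun x hx => ?_⟩
  -- Back from `H` to the integral of `e`: the latter is monotone in its endpoint, so averaging the
  -- hypothesis over `[x, x + 1]` suffices; hence the loss of one unit in `x₁ - 1`.
  have h1 : ∫ t in Iic x, e t ≤ C * H (x + 1) := by
    calc ∫ t in Iic x, e t = ∫ t in x..(x + 1), ∫ s in Iic x, e s := by simp
      _ ≤ ∫ t in x..(x + 1), C * h t := by
          refine intervalIntegral.integral_mono_on (by linarith) (by simp)
            ((hh.const_mul C).intervalIntegrable _ _) fun t ht => ?_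
          exact (setIntegral_Iic_mono he he0 ht.1).trans (hle t (by linarith [ht.2]))
      _ = C * ∫ t in x..(x + 1), h t := intervalIntegral.integral_const_mul _ _
      _ ≤ C * H (x + 1) := by
          gcongr
          exact intervalIntegral_le_setIntegral_Iic hhi hh0 (by linarith) le_rfl
  have h2 := hHexp (x + 1) (by linarith)
  rw [mul_add, mul_one, Real.exp_add] at h2
  have h3 : 0 < Real.exp (C⁻¹ * x) := Real.exp_pos _
  nlinarith [mul_le_mul_of_nonneg_left h2 hC.le]

/-! ### From energy to pointwise behaviour at `-∞`. -/

section Decay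

variable {m : ℕ} {u v z : ℝ → EuclideanSpace ℝ (Fin m)}

/-- Young's inequality `|z| ≤ δ + δ⁻¹ |z|² / 2`, integrated. Taking `δ` of the order of the square
root of the tail energy yields an oscillation of that same order on bounded intervals. -/
theorem HasSecondDeriv.norm_deriv_sub_le (h : HasSecondDeriv u v z) {f : ℝ → ℝ} (hf : Integrable f)
    (hzf : ∀ x, 1 / 2 * ‖z x‖ ^ 2 ≤ f x) {δ : ℝ} (hδ : 0 < δ) {t s x : ℝ} (hts : t ≤ s)
    (hsx : s ≤ x) : ‖v s - v t‖ ≤ δ * (s - t) + δ⁻¹ * ∫ y in Iic x, f y := by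
  have hf0 : ∀ x, 0 ≤ f x := fun x => le_trans (by positivity) (hzf x)
  rw [← h.integral_eq_sub]
  calc ‖∫ y in t..s, z y‖ ≤ ∫ y in t..s, (δ + δ⁻¹ * f y) := by
        refine intervalIntegral.norm_integral_le_of_norm_le hts (Eventually.of_forall fun y _ => ?_)
          (intervalIntegrable_const.add (hf.intervalIntegrable.const_mul _))
        have h1 := mul_le_mul_of_nonneg_left (hzf y) (inv_pos.2 hδ).le
        refine le_trans ?_ (add_le_add_right h1 δ)
        have h2 : 0 ≤ δ⁻¹ * ((‖z y‖ - δ) ^ 2 + δ ^ 2) := by positivity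
        have h3 : δ⁻¹ * δ = 1 := inv_mul_cancel₀ hδ.ne'
        have h4 : δ⁻¹ * ((‖z y‖ - δ) ^ 2 + δ ^ 2)
            = δ⁻¹ * ‖z y‖ ^ 2 - 2 * (δ⁻¹ * δ) * ‖z y‖ + 2 * (δ⁻¹ * δ) * δ := by ring
        rw [h3] at h4
        linarith
    _ = δ * (s - t) + δ⁻¹ * ∫ y in t..s, f y := by
        rw [intervalIntegral.integral_add intervalIntegrable_const
          (hf.intervalIntegrable.const_mul _), intervalIntegral.integral_const_mul,
          intervalIntegral.integral_const, smul_eq_mul, mul_comm]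
    _ ≤ _ := by
        gcongr
        exact intervalIntegral_le_setIntegral_Iic hf hf0 hts hsx

theorem HasSecondDeriv.norm_sub_le (h : HasSecondDeriv u v z) {B t s : ℝ} (hts : t ≤ s)
    (hB : ∀ y ∈ Icc t s, ‖v y‖ ≤ B) : ‖u s - u t‖ ≤ B * (s - t) := by
  rw [← h.integral_deriv_eq_sub, ← abs_of_nonneg (sub_nonneg.2 hts)]
  refine intervalIntegral.norm_integral_le_of_norm_le_const fun y hy => hB y ?_
  rw [uIoc_of_le hts] at hy
  exact Ioc_subset_Icc_self hy

/-- The derivative of a function which is bounded near `-∞`, with square integrable second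
derivative, vanishes at `-∞`. -/
theorem HasSecondDeriv.tendsto_deriv_atBot (h : HasSecondDeriv u v z) {f : ℝ → ℝ}
    (hf : Integrable f) (hzf : ∀ x, 1 / 2 * ‖z x‖ ^ 2 ≤ f x) {M x₀ : ℝ}
    (hM : ∀ x ≤ x₀, ‖u x‖ ≤ M) : Tendsto v atBot (𝓝 0) := by
  rw [tendsto_zero_iff_norm_tendsto_zero, Metric.tendsto_nhds]
  intro ε hε
  have hM0 : 0 ≤ M := (norm_nonneg _).trans (hM x₀ le_rfl)
  -- If `|v x| ≥ ε` and `v` varies by at most `ε / 4` on `[x - L, x]`, then `4(M + 1) = Lε ≤ 2M + Lε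
  -- / 4 = 3M + 1`, which is absurd. The choice of `δ` gives `δL = ε / 8`.
  set L := 4 * (M + 1) / ε with hL
  have hL0 : 0 < L := by positivity
  set δ := ε / (8 * L) with hδ
  have hδ0 : 0 < δ := by positivity
  have hE : ∀ᶠ x in atBot, ∫ y in Iic x, f y < δ * (ε / 8) := by
    have := tendsto_integral_Iic_zero (f := f) (μ := volume) (a := id) (l := atBot) tendsto_id
    exact this.eventually (gt_mem_nhds (by positivity))
  filter_upwards [hE, eventually_le_atBot x₀] with x hx hxx
  rw [dist_zero_right, norm_norm]
  have hosc : ∀ t ∈ Icc (x - L) x, ‖v x - v t‖ ≤ ε / 4 := by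
    intro t ht
    have h1 := h.norm_deriv_sub_le hf hzf hδ0 ht.2 (le_refl x)
    have h2 : δ * (x - t) ≤ ε / 8 := by
      calc δ * (x - t) ≤ δ * L := by gcongr; linarith [ht.1]
        _ = ε / 8 := by rw [hδ]; field_simp
    have h3 : δ⁻¹ * ∫ y in Iic x, f y ≤ ε / 8 := by
      rw [inv_mul_le_iff₀ hδ0]; exact hx.le
    linarith
  have hkey : L • v x = (u x - u (x - L)) + ∫ t in (x - L)..x, (v x - v t) := by
    rw [intervalIntegral.integral_sub intervalIntegrable_const
      (h.continuous_deriv.intervalIntegrable _ _), h.integral_deriv_eq_sub,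
      intervalIntegral.integral_const]
    simp
  have hint : ‖∫ t in (x - L)..x, (v x - v t)‖ ≤ ε / 4 * L := by
    have := intervalIntegral.norm_integral_le_of_norm_le_const (a := x - L) (b := x)
      (f := fun t => v x - v t) (C := ε / 4) fun t ht => hosc t (by
        rw [uIoc_of_le (by linarith)] at ht
        exact Ioc_subset_Icc_self ht)
    rwa [sub_sub_cancel, abs_of_pos hL0] at this
  have hu1 := hM x hxx
  have hu2 := hM (x - L) (by linarith)
  have hnorm : L * ‖v x‖ ≤ 2 * M + ε / 4 * L := by
    calc L * ‖v x‖ = ‖L • v x‖ := by rw [norm_smul, Real.norm_of_nonneg hL0.le]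
      _ ≤ ‖u x‖ + ‖u (x - L)‖ + ‖∫ t in (x - L)..x, (v x - v t)‖ := by
          rw [hkey]
          exact (norm_add_le _ _).trans (add_le_add_left (_root_.norm_sub_le _ _) _)
      _ ≤ _ := by linarith
  have hLε : L * ε = 4 * (M + 1) := by rw [hL]; field_simp
  by_contra hcon
  have := mul_le_mul_of_nonneg_left (not_lt.1 hcon) hL0.le
  nlinarith

/-- A map of finite energy which stays close to `S`, where `W(·, 0)` vanishes only on `S`, converges
to `S`. -/
theorem HasSecondDeriv.tendsto_infDist_atBot (h : HasSecondDeriv u v z) {f : ℝ → ℝ}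
    {W : EuclideanSpace ℝ (Fin m) × EuclideanSpace ℝ (Fin m) → ℝ} (hW : Continuous W)
    (hf : Integrable f) (hWf : ∀ x, W (u x, v x) ≤ f x) (hf0 : ∀ x, 0 ≤ f x)
    {S : Set (EuclideanSpace ℝ (Fin m))} (hS : IsCompact S) {q x₀ : ℝ}
    (hSW : ∀ y, Metric.infDist y S ≤ q → 0 < Metric.infDist y S → 0 < W (y, 0))
    (hM : ∀ x ≤ x₀, Metric.infDist (u x) S ≤ q) (hv : Tendsto v atBot (𝓝 0)) :
    Tendsto (fun x => Metric.infDist (u x) S) atBot (𝓝 0) := by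
  rcases S.eq_empty_or_nonempty with rfl | hne
  · simp
  rw [Metric.tendsto_nhds]
  intro ε hε
  -- On this compact shell `W(·, 0) > 0`, and the tube lemma extends a uniform positive bound to
  -- small velocities.
  set Q : Set (EuclideanSpace ℝ (Fin m)) :=
    {y | Metric.infDist y S ≤ q ∧ ε / 2 ≤ Metric.infDist y S} with hQ
  have hQc : IsCompact Q := by
    have hd := Metric.continuous_infDist_pt S
    refine Metric.isCompact_of_isClosed_isBounded
      ((isClosed_le hd continuous_const).inter (isClosed_le continuous_const hd)) ?_
    refine (hS.isBounded.cthickening (δ := q)).subset fun y hy => ?_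
    obtain ⟨a, ha, hya⟩ := hS.exists_infDist_eq_dist hne y
    exact Metric.mem_cthickening_of_dist_le y a q S ha (hya ▸ hy.1)
  obtain ⟨U, V, hU, hV, hQU, hV0, hUV⟩ := generalized_tube_lemma hQc
    (isCompact_singleton (x := (0 : EuclideanSpace ℝ (Fin m))))
    (isOpen_lt continuous_const hW : IsOpen {y | 0 < W y}) (by
      rintro ⟨y, w⟩ ⟨hy, hw⟩
      obtain rfl : w = 0 := hw
      exact hSW y hy.1 (by linarith [hy.2]))
  obtain ⟨ρ, hρ, hρV⟩ := Metric.nhds_basis_closedBall.mem_iff.1 (hV.mem_nhds (hV0 rfl))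
  obtain ⟨c, hc, hcW⟩ := (hQc.prod (isCompact_closedBall (0 : EuclideanSpace ℝ (Fin m)) ρ)).exists_forall_le'
    hW.continuousOn (a := 0) fun y hy => hUV ⟨hQU hy.1, hρV hy.2⟩
  have hE : ∀ᶠ x in atBot, ∫ y in Iic x, f y < c := by
    have := tendsto_integral_Iic_zero (f := f) (μ := volume) (a := id) (l := atBot) tendsto_id
    exact this.eventually (gt_mem_nhds hc)
  have hvs : ∀ᶠ x in atBot, ‖v x‖ ≤ min ρ (ε / 2) := by
    have := (tendsto_zero_iff_norm_tendsto_zero.1 hv).eventually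
      (gt_mem_nhds (show 0 < min ρ (ε / 2) by positivity))
    exact this.mono fun x hx => hx.le
  obtain ⟨x₁, hx₁⟩ := eventually_atBot.1 hvs
  filter_upwards [hE, eventually_le_atBot x₁, eventually_le_atBot x₀] with x hxE hx1 hx0
  rw [dist_zero_right, Real.norm_of_nonneg Metric.infDist_nonneg]
  by_contra hcon
  have hcon := not_lt.1 hcon
  -- Speed at most `ε / 2` keeps `u` in the shell for a unit of time before `x`, which costs energy
  -- at least `c`, more than the tail contains.
  have hlow : ∀ t ∈ Icc (x - 1) x, c ≤ f t := by
    intro t ht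
    have h1 : ‖u x - u t‖ ≤ ε / 2 * (x - t) := h.norm_sub_le ht.2 fun y hy =>
      (hx₁ y (hy.2.trans hx1)).trans (min_le_right _ _)
    have h2 : Metric.infDist (u x) S ≤ Metric.infDist (u t) S + dist (u x) (u t) :=
      Metric.infDist_le_infDist_add_dist
    rw [dist_eq_norm] at h2
    have h3 : ε / 2 * (x - t) ≤ ε / 2 := by nlinarith [ht.1]
    refine (hcW (u t, v t) ⟨⟨hM t (ht.2.trans hx0), by linarith⟩, ?_⟩).trans (hWf t)
    rw [mem_closedBall_zero_iff]
    exact (hx₁ t (ht.2.trans hx1)).trans (min_le_left _ _)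
  have : c ≤ ∫ t in (x - 1)..x, f t := by
    calc c = ∫ _ in (x - 1)..x, c := by simp
      _ ≤ _ := intervalIntegral.integral_mono_on (by linarith) intervalIntegrable_const
        hf.intervalIntegrable hlow
  linarith [intervalIntegral_le_setIntegral_Iic hf hf0 (by linarith : x - 1 ≤ x) le_rfl]

/-- Exponential decay of the energy near `-∞` gives pointwise exponential decay. -/
theorem HasSecondDeriv.exists_exp_bound (h : HasSecondDeriv u v z) {f : ℝ → ℝ}
    (hf : Integrable f) (hzf : ∀ x, 1 / 2 * ‖z x‖ ^ 2 ≤ f x)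
    {S : Set (EuclideanSpace ℝ (Fin m))} {c x₁ K k : ℝ} (hc : 0 < c) (hK : 0 < K)
    (hlow : ∀ x ≤ x₁, c * (Metric.infDist (u x) S ^ 2 + ‖v x‖ ^ 2) ≤ f x)
    (hE : ∀ x ≤ x₁, ∫ y in Iic x, f y ≤ K * Real.exp (k * x)) :
    ∃ K' > 0, ∀ x ≤ x₁, Metric.infDist (u x) S ≤ K' * Real.exp (k / 2 * x) ∧
      ‖v x‖ ≤ K' * Real.exp (k / 2 * x) := by
  have hf0 : ∀ x, 0 ≤ f x := fun x => le_trans (by positivity) (hzf x)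
  set M := Real.sqrt ((K + 1) / c) with hM
  have hM0 : 0 ≤ M := Real.sqrt_nonneg _
  have hM2 : c * M ^ 2 = K + 1 := by
    rw [hM, Real.sq_sqrt (by positivity)]; field_simp
  refine ⟨2 * M + 2 * (1 + K), by positivity, fun x hx => ?_⟩
  set σ := Real.exp (k / 2 * x) with hσ
  have hσ0 : 0 < σ := Real.exp_pos _
  have hσ2 : σ ^ 2 = Real.exp (k * x) := by
    rw [hσ, sq, ← Real.exp_add]; ring_nf
  have hEx := hE x hx
  rw [← hσ2] at hEx
  -- The density cannot exceed its mean throughout the interval; `K + 1` instead of `K` leaves room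
  -- for a strict contradiction.
  obtain ⟨y, hy, hfy⟩ : ∃ y ∈ Icc (x - 1) x, f y ≤ (K + 1) * σ ^ 2 := by
    by_contra! hcon
    have h1 : (K + 1) * σ ^ 2 ≤ ∫ t in (x - 1)..x, f t := by
      calc (K + 1) * σ ^ 2 = ∫ _ in (x - 1)..x, (K + 1) * σ ^ 2 := by simp
        _ ≤ _ := intervalIntegral.integral_mono_on (by linarith) intervalIntegrable_const
          hf.intervalIntegrable fun t ht => (hcon t ht).le
    have h2 := intervalIntegral_le_setIntegral_Iic hf hf0 (by linarith : x - 1 ≤ x) le_rfl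
    nlinarith [sq_pos_of_pos hσ0]
  have hy1 := (hlow y (hy.2.trans hx)).trans hfy
  have hsq : Metric.infDist (u y) S ^ 2 + ‖v y‖ ^ 2 ≤ (M * σ) ^ 2 := by
    rw [← hM2, mul_assoc] at hy1
    rw [mul_pow]
    exact le_of_mul_le_mul_left hy1 hc
  have hdy : Metric.infDist (u y) S ≤ M * σ :=
    abs_le_of_sq_le_sq' (by nlinarith [sq_nonneg ‖v y‖]) (by positivity) |>.2
  have hvy : ‖v y‖ ≤ M * σ :=
    abs_le_of_sq_le_sq' (by nlinarith [sq_nonneg (Metric.infDist (u y) S)]) (by positivity) |>.2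
  have hosc : ∀ t ∈ Icc y x, ‖v t‖ ≤ (M + (1 + K)) * σ := by
    intro t ht
    -- With `δ = σ` and tail energy at most `K σ²`, both terms are of order `σ`; hence the rate `k /
    -- 2`.
    have h1 := h.norm_deriv_sub_le hf hzf hσ0 ht.1 ht.2
    have h2 : σ * (t - y) ≤ σ := by nlinarith [hy.1, ht.2]
    have h3 : σ⁻¹ * ∫ y in Iic x, f y ≤ K * σ := by
      rw [inv_mul_le_iff₀ hσ0]; linarith
    have h4 : ‖v t‖ ≤ ‖v y‖ + ‖v t - v y‖ := by
      simpa using norm_add_le (v y) (v t - v y)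
    linarith
  have hux : ‖u x - u y‖ ≤ (M + (1 + K)) * σ := by
    refine (h.norm_sub_le hy.2 hosc).trans ?_
    have : 0 ≤ (M + (1 + K)) * σ := by positivity
    nlinarith [hy.1]
  constructor
  · have : Metric.infDist (u x) S ≤ Metric.infDist (u y) S + dist (u x) (u y) :=
      Metric.infDist_le_infDist_add_dist
    rw [dist_eq_norm] at this
    nlinarith [mul_pos hK hσ0]
  · refine (hosc x ⟨hy.2, le_rfl⟩).trans ?_
    nlinarith [mul_nonneg hM0 hσ0.le, mul_pos hK hσ0]

end Decay

/-! ### Extension to the half line and conclusion. -/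

/-- Exponential bounds near `-∞` of continuous functions extend to the half line `x ≤ 0`. -/
theorem exists_exp_bound_of_le {f g : ℝ → ℝ} (hf : Continuous f) (hg : Continuous g)
    {K k x₁ : ℝ} (hK : 0 < K) (hle : ∀ x ≤ x₁, f x ≤ K * Real.exp (k * x) ∧
      g x ≤ K * Real.exp (k * x)) :
    ∃ K' > 0, ∀ x ≤ 0, f x ≤ K' * Real.exp (k * x) ∧ g x ≤ K' * Real.exp (k * x) := by
  have hd : Continuous fun x => max (f x) (g x) * Real.exp (-(k * x)) := by fun_prop
  obtain ⟨B, hB⟩ := (isCompact_Icc (a := x₁) (b := 0)).bddAbove_image hd.continuousOn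
  refine ⟨max K B, lt_max_of_lt_left hK, fun x hx => ?_⟩
  rw [← max_le_iff]
  rcases le_total x x₁ with h | h
  · exact (max_le (hle x h).1 (hle x h).2).trans (by gcongr; exact le_max_left _ _)
  · have h1 := hB ⟨x, ⟨h, hx⟩, rfl⟩
    calc max (f x) (g x) = max (f x) (g x) * Real.exp (-(k * x)) * Real.exp (k * x) := by
          rw [mul_assoc, ← Real.exp_add]; simp
      _ ≤ max K B * Real.exp (k * x) := by
          gcongr
          exact h1.trans (le_max_right _ _)

theorem proposition3p1 (m : ℕ)
    (W : EuclideanSpace ℝ (Fin m) × EuclideanSpace ℝ (Fin m) → ℝ)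
    (hW : ContDiff ℝ 2 W) (hW0 : ∀ p, 0 ≤ W p)
    -- the zero set of `W(·, 0)` is partitioned into two nonempty compact sets
    (Am Ap : Set (EuclideanSpace ℝ (Fin m)))
    (hA : {u | W (u, 0) = 0} = Am ∪ Ap) (hdisj : Disjoint Am Ap)
    (hAm : Am.Nonempty) (hAp : Ap.Nonempty) (hAmc : IsCompact Am) (hApc : IsCompact Ap)
    -- the separating open set
    (Ω : Set (EuclideanSpace ℝ (Fin m))) (hΩ : IsOpen Ω) (hAmΩ : Am ⊆ Ω)
    (hApΩ : Ap ∩ closure Ω = ∅) (hWΩ : ∀ u ∈ frontier Ω, ∀ v, 0 < W (u, v))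
    -- `liminf W(u, v) > 0` as `|u| → ∞`, uniformly in `v`
    (hinf : ∃ R : ℝ, ∃ c > 0, ∀ u, R ≤ ‖u‖ → ∀ v, c ≤ W (u, v))
    -- the radius `q` in the definition of the admissible class
    (q : ℝ) (hq : 0 < q) (hqd : ∀ a ∈ Am, ∀ b ∈ Ap, q < dist a b / 2)
    (hqm : {u | Metric.infDist u Am ≤ q} ⊆ Ω)
    (hqp : {u | Metric.infDist u Ap ≤ q} ∩ closure Ω = ∅)
    -- `Am` is a `C²` hypersurface oriented by `n`
    (hS : IsC2Hypersurface Am)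
    (n : EuclideanSpace ℝ (Fin m) → EuclideanSpace ℝ (Fin m)) (hn : IsUnitNormalField Am n)
    -- nondegeneracy of `W` in the unit directions `(α n, ν)` normal to `Am × {0}`
    (hnondeg : ∀ a ∈ Am, ∀ (α : ℝ) (ν : EuclideanSpace ℝ (Fin m)), α ^ 2 + ‖ν‖ ^ 2 = 1 →
      0 < iteratedDeriv 2 (fun s : ℝ => W (a + s • α • n a, s • ν)) 0)
    (u : ℝ → EuclideanSpace ℝ (Fin m)) (hu : IsMinimizer W Am Ap q u) :
    ContDiff ℝ 1 u ∧ ∃ K > 0, ∃ k > 0, ∀ x ≤ 0,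
      Metric.infDist (u x) Am ≤ K * Real.exp (k * x) ∧
      ‖deriv u x‖ ≤ K * Real.exp (k * x) := by
  have hzero : ∀ a ∈ Am ∪ Ap, W (a, 0) = 0 := fun a ha => hA.ge ha
  have hzero' : ∀ a ∈ Am, W (a, 0) = 0 := fun a ha => hzero a (Or.inl ha)
  obtain ⟨v, z, h⟩ := hu.1.1.exists_hasSecondDeriv
  obtain ⟨xm, xp, hxmp, hxm, hxp⟩ := hu.1.2
  refine ⟨h.contDiff_one, ?_⟩
  obtain rfl : deriv u = v := funext fun x => (h.hasDerivAt x).deriv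
  have hfin : energy W u ≠ ⊤ := by
    obtain ⟨a, ha⟩ := hAm
    obtain ⟨b, hb⟩ := hAp
    obtain ⟨w, hw, hwfin⟩ := exists_admissible_energy_ne_top hW.continuous hq ha hb
      (hzero' a ha) (hzero b (Or.inr hb))
    exact ne_top_of_le_ne_top hwfin (hu.2 w hw)
  have hint := h.integrable_density hW.continuous hW0 hfin
  set f : ℝ → ℝ := fun x => 1 / 2 * ‖z x‖ ^ 2 + W (u x, deriv u x)
  have hzf : ∀ x, 1 / 2 * ‖z x‖ ^ 2 ≤ f x := fun x => le_add_of_nonneg_right (hW0 _)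
  have hWf : ∀ x, W (u x, deriv u x) ≤ f x := fun x => le_add_of_nonneg_left (by positivity)
  have hf0 : ∀ x, 0 ≤ f x := fun x => (hW0 _).trans (hWf x)
  obtain ⟨M, hM⟩ : ∃ M, ∀ x ≤ xm, ‖u x‖ ≤ M := by
    obtain ⟨M, hM⟩ := (hAmc.isBounded.cthickening (δ := q)).exists_norm_le
    refine ⟨M, fun x hx => hM _ ?_⟩
    obtain ⟨a, ha, hxa⟩ := hAmc.exists_infDist_eq_dist hAm (u x)
    exact Metric.mem_cthickening_of_dist_le (u x) a q Am ha (hxa ▸ hxm x hx)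
  have hv0 := h.tendsto_deriv_atBot hint hzf hM
  have hd0 := h.tendsto_infDist_atBot hW.continuous hint hWf hf0 hAmc (q := q)
    (fun y hy hy0 => by
      refine (hW0 _).lt_of_ne' fun hWy => ?_
      have hyA : y ∈ Am ∪ Ap := hA ▸ hWy
      rcases hyA with hyA | hyA
      · rw [Metric.infDist_zero_of_mem hyA] at hy0
        exact lt_irrefl _ hy0
      -- A zero in `Ap` would lie within `q` of `Am`, although the two sets are more than `2q`
      -- apart.
      · obtain ⟨a, ha, hya⟩ := hAmc.exists_infDist_eq_dist hAm y
        have := hqd a ha y hyA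
        rw [dist_comm, ← hya] at this
        linarith) hxm hv0
  obtain ⟨c, hc, r, hr, hlow⟩ := exists_nondegenerate_lower_bound hW hW0 hAm hAmc hzero' hS hn hnondeg
  obtain ⟨C, hC, hup⟩ := exists_quadratic_upper_bound hW hW0
    (hAmc.prod (isCompact_singleton (x := (0 : EuclideanSpace ℝ (Fin m))))) (by
      rintro ⟨a, w⟩ ⟨ha, hw⟩
      obtain rfl : w = 0 := hw
      exact hzero' a ha)
  -- `r` serves the lower bound; `1 / 4` for each of the two terms gives the smallness `1 / 2`
  -- required by the comparison.
  have hsmall : 0 < min r (1 / 4) := by positivity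
  obtain ⟨x₁, hx₁⟩ := eventually_atBot.1 (((hd0.eventually (gt_mem_nhds hsmall)).and
    ((tendsto_zero_iff_norm_tendsto_zero.1 hv0).eventually (gt_mem_nhds hsmall))))
  have hgrow : ∀ x ≤ x₁, c * (Metric.infDist (u x) Am ^ 2 + ‖deriv u x‖ ^ 2) ≤
      W (u x, deriv u x) := fun x hx =>
    hlow _ _ ((hx₁ x hx).1.le.trans (min_le_left _ _)) ((hx₁ x hx).2.le.trans (min_le_left _ _))
  -- The factor `2` comes from `(a + b)² ≤ 2 (a² + b²)`, and `1 / c` from the lower bound on `W`.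
  set B := 2 * (18 + 4 * C) / c
  have hB : 0 < B := by positivity
  have hE : ∀ x ≤ x₁, ∫ t in Iic x, f t ≤ B * W (u x, deriv u x) := by
    intro x hx
    obtain ⟨a, ha, hxa⟩ := hAmc.exists_infDist_eq_dist hAm (u x)
    obtain ⟨h1, h2⟩ := hx₁ x hx
    have h3 := hgrow x hx
    rw [hxa, dist_eq_norm] at h1 h3
    have h4 := min_le_right r (1 / 4)
    refine (hu.setIntegral_Iic_density_le h hW.continuous hW0 hq hfin ha (hzero' a ha)
      (fun w hw => hup (a, 0) ⟨ha, rfl⟩ w hw) hC hxp (by linarith)).trans ?_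
    calc (18 + 4 * C) * (‖u x - a‖ + ‖deriv u x‖) ^ 2
        ≤ (18 + 4 * C) * (2 * (‖u x - a‖ ^ 2 + ‖deriv u x‖ ^ 2)) := by
          gcongr
          nlinarith [sq_nonneg (‖u x - a‖ - ‖deriv u x‖)]
      _ = B * (c * (‖u x - a‖ ^ 2 + ‖deriv u x‖ ^ 2)) := by
          simp only [B]; field_simp
      _ ≤ B * W (u x, deriv u x) := by gcongr
  obtain ⟨K, hK, hEK⟩ := exists_exp_bound_setIntegral_Iic hint
    (hW.continuous.comp (h.continuous.prodMk h.continuous_deriv)) (fun x => hW0 _) hWf hB hE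
  obtain ⟨K', hK', hdecay⟩ := h.exists_exp_bound hint hzf (S := Am) hc hK
    (fun x hx => (hgrow x (by linarith)).trans (hWf x)) hEK
  obtain ⟨K'', hK'', hfinal⟩ := exists_exp_bound_of_le
    ((Metric.continuous_infDist_pt Am).comp h.continuous) h.continuous_deriv.norm hK' hdecay
  exact ⟨K'', hK'', B⁻¹ / 2, by positivity, hfinal⟩
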